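/- Let $k$ be a field. Dg categories over $k$ are small and cohomologically graded (differential $d$ of degree $+1$, $d(g\circ f)=dg\circ f+(-1)^{|g|}g\circ df$). For dg categories $C,D$, the tensor product $C\otimes D$ has objects $\mathrm{Ob}(C)\times\mathrm{Ob}(D)$, Hom-complexes $C(c,c')\otimes_k D(d,d')$, and composition $(f\otimes g)\circ(f'\otimes g')=(-1)^{|g||f'|}(f\circ f')\otimes(g\circ g')$. The twisted tensor product $C\tilde\otimes D$ has objects $\mathrm{Ob}(C)\times\mathrm{Ob}(D)$. Its morphisms are generated, as those of a graded $k$-linear category, by morphisms $f\otimes\mathrm{id}_d$ and $\mathrm{id}_c\otimes g$ ($f$ in $C$, $g$ in $D$ homogeneous, of degrees $|f|$, $|g|$) and by morphisms $\varepsilon(f;g_1,\dots,g_n)\colon(c_0,d_0)\to(c_1,d_n)$ of degree $|f|+\sum_j|g_j|-n$ for $n\ge1$, $f\colon c_0\to c_1$ in $C$ and composable $d_0\xrightarrow{g_1}d_1\to\cdots\xrightarrow{g_n}d_n$ in $D$; for $n=0$ write $\varepsilon(f;)=f\otimes\mathrm{id}_{d_0}$. It is the quotient of the free graded $k$-linear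 category on these generators by the two-sided dg ideal generated by the following relations: 1. $f\otimes\mathrm{id}_d$ and $\mathrm{id}_c\otimes g$ are linear and multiplicative in $f$ and $g$, and $\mathrm{id}_c\otimes\mathrm{id}_d=\mathrm{id}_{(c,d)}$; 2. $\varepsilon(f;g_1,\dots,g_n)$ is linear in each argument; 3. for $n\ge1$, $\varepsilon(f;g_1,\dots,g_n)=0$ if $f$ or one of the $g_i$ is an identity morphism; 4. $\varepsilon(f_2f_1;g_1,\dots,g_N)=\sum_{m=0}^N(-1)^{|f_1|\sum_{j>m}(|g_j|+1)}\,\varepsilon(f_2;g_{m+1},\dots,g_N)\,\varepsilon(f_1;g_1,\dots,g_m)$. The differential is the derivation with $d(f\otimes\mathrm{id})=df\otimes\mathrm{id}$, $d(\mathrm{id}\otimes g)=\mathrm{id}\otimes dg$ and, for $n\ge1$, $$\begin{aligned}d\varepsilon(f;g_1,\dots,g_n)={}&\varepsilon(df;g_1,\dots,g_n)-\sum_{j=1}^n(-1)^{|f|+\sum_{i>j}(|g_i|+1)}\varepsilon(f;g_1,\dots,dg_j,\dots,g_n)\\&-(-1)^{|f||g_n|+|f|}(\mathrm{id}_{c_1}\otimes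 g_n)\,\varepsilon(f;g_1,\dots,g_{n-1})+(-1)^{|f|+\sum_{i\ge2}(|g_i|+1)}\varepsilon(f;g_2,\dots,g_n)\,(\mathrm{id}_{c_0}\otimes g_1)\\&-\sum_{i=1}^{n-1}(-1)^{|f|+\sum_{j>i}(|g_j|+1)}\varepsilon(f;g_1,\dots,g_{i+1}\circ g_i,\dots,g_n).\end{aligned}$$ There is a dg functor $p\colon C\tilde\otimes D\to C\otimes D$, the natural projection, which is the identity on objects, sends $f\otimes\mathrm{id}$ and $\mathrm{id}\otimes g$ to the morphisms of the same name, and sends all $\varepsilon(f;g_1,\dots,g_s)$ with $s\ge1$ to $0$. For $n\ge0$, let $I_n$ be the dg category with objects $0,1,\dots,n$, with $I_n(i,j)=k$ in degree $0$ if $i\le j$ and $I_n(i,j)=0$ otherwise, zero differential, and composition the product of $k$. **Theorem.** For every small dg category $C$ over $k$ (not necessarily cofibrant) and every $n\ge0$, the natural projection $p\colon I_n\tilde\otimes C\to I_n\otimes C$ is a quasi-equivalence: it induces isomorphisms on the cohomology of all Hom-complexes, and the induced functor $H^0(I_n\tilde\otimes C)\to H^0(I_n\otimes C)$ is essentially surjective.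 -/

import Mathlib

open scoped TensorProduct

universe w u v u₁ v₁ u₂ v₂

noncomputable section

/-- The sign `(-1)^n`, `n ∈ ℤ`, as a scalar of `k`. -/
def sgn (k : Type w) [Field k] (n : ℤ) : k := ((n.negOnePow : ℤˣ) : ℤ)

theorem sgn_add (k : Type w) [Field k] (m n : ℤ) : sgn k (m + n) = sgn k m * sgn k n := by
  simp [sgn, Int.negOnePow_add]

theorem sgn_one (k : Type w) [Field k] : sgn k 1 = -1 := by
  simp [sgn]

theorem sgn_zero (k : Type w) [Field k] : sgn k 0 = 1 := by
  simp [sgn]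

theorem sgn_mul_self (k : Type w) [Field k] (n : ℤ) : sgn k n * sgn k n = 1 := by
  rw [← sgn_add]
  simp [sgn, Int.negOnePow_even _ (Even.add_self n)]

/-! ## Differential graded categories -/

/-- A small dg category over the field `k`, with cohomological grading (differential of degree
`+1`). `Hom X Y n` is the degree `n` component of the Hom complex; `comp h g f` is the composite
`g ∘ f`. To avoid casts, degrees of results are free variables tied by an equation. -/
structure DGCat (k : Type w) [Field k] where
  Obj : Type u
  Hom : Obj → Obj → ℤ → Type v
  [addCommGroup : ∀ X Y n, AddCommGroup (Hom X Y n)]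
  [module : ∀ X Y n, Module k (Hom X Y n)]
  d : ∀ {X Y : Obj} (n m : ℤ), n + 1 = m → (Hom X Y n →ₗ[k] Hom X Y m)
  id : ∀ X : Obj, Hom X X 0
  comp : ∀ {X Y Z : Obj} {p q n : ℤ}, q + p = n →
    (Hom Y Z q →ₗ[k] Hom X Y p →ₗ[k] Hom X Z n)
  d_d : ∀ {X Y : Obj} {n m l : ℤ} (h : n + 1 = m) (h' : m + 1 = l) (f : Hom X Y n),
    d m l h' (d n m h f) = 0
  id_comp : ∀ {X Y : Obj} {n : ℤ} (h : 0 + n = n) (f : Hom X Y n), comp h (id Y) f = f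
  comp_id : ∀ {X Y : Obj} {n : ℤ} (h : n + 0 = n) (f : Hom X Y n), comp h f (id X) = f
  assoc : ∀ {W X Y Z : Obj} {p q r pq qr n : ℤ} (h₁ : r + q = qr) (h₂ : qr + p = n)
    (h₃ : q + p = pq) (h₄ : r + pq = n) (c : Hom Y Z r) (b : Hom X Y q) (a : Hom W X p),
    comp h₂ (comp h₁ c b) a = comp h₄ c (comp h₃ b a)
  leibniz : ∀ {X Y Z : Obj} {p q n m p' q' : ℤ} (h : q + p = n) (hn : n + 1 = m)
    (hp : p + 1 = p') (hq : q + 1 = q') (h₁ : q' + p = m) (h₂ : q + p' = m)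
    (g : Hom Y Z q) (f : Hom X Y p),
    d n m hn (comp h g f) = comp h₁ (d q q' hq g) f + sgn k q • comp h₂ g (d p p' hp f)

attribute [instance] DGCat.addCommGroup DGCat.module

namespace DGCat

variable {k : Type w} [Field k]

theorem d_id (C : DGCat.{w, u, v} k) (X : C.Obj) (m : ℤ) (h : 0 + 1 = m) :
    C.d 0 m h (C.id X) = 0 := by
  obtain rfl : 1 = m := by omega
  have := C.leibniz (add_zero 0) h h h (add_zero 1) (zero_add 1) (C.id X) (C.id X)
  rw [C.id_comp, C.comp_id, C.id_comp, sgn_zero, one_smul] at this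
  simpa using this

/-- Cocycles of degree `n` in the Hom complex. -/
abbrev Cocycles (C : DGCat.{w, u, v} k) (X Y : C.Obj) (n : ℤ) : Submodule k (C.Hom X Y n) :=
  LinearMap.ker (C.d (X := X) (Y := Y) n (n + 1) rfl)

/-- Coboundaries of degree `n` in the Hom complex. -/
abbrev Coboundaries (C : DGCat.{w, u, v} k) (X Y : C.Obj) (n : ℤ) :
    Submodule k (C.Hom X Y n) :=
  LinearMap.range (C.d (X := X) (Y := Y) (n - 1) n (sub_add_cancel n 1))

/-- The cohomology `Hⁿ` of the Hom complex from `X` to `Y`. -/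
abbrev Cohomology (C : DGCat.{w, u, v} k) (X Y : C.Obj) (n : ℤ) : Type v :=
  C.Cocycles X Y n ⧸ (C.Coboundaries X Y n).submoduleOf (C.Cocycles X Y n)

/-- `X` and `Y` are isomorphic in the homotopy category `H⁰(C)`. -/
def HomotopyEquivalent (C : DGCat.{w, u, v} k) (X Y : C.Obj) : Prop :=
  ∃ a ∈ C.Cocycles X Y 0, ∃ b ∈ C.Cocycles Y X 0,
    C.comp (add_zero 0) b a - C.id X ∈ C.Coboundaries X X 0 ∧
    C.comp (add_zero 0) a b - C.id Y ∈ C.Coboundaries Y Y 0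

end DGCat

/-- A dg functor. -/
structure DGFunctor {k : Type w} [Field k] (C : DGCat.{w, u₁, v₁} k)
    (D : DGCat.{w, u₂, v₂} k) where
  obj : C.Obj → D.Obj
  map : ∀ {X Y : C.Obj} {n : ℤ}, C.Hom X Y n →ₗ[k] D.Hom (obj X) (obj Y) n
  map_d : ∀ {X Y : C.Obj} {n m : ℤ} (h : n + 1 = m) (f : C.Hom X Y n),
    map (C.d n m h f) = D.d n m h (map f)
  map_id : ∀ X : C.Obj, map (C.id X) = D.id (obj X)
  map_comp : ∀ {X Y Z : C.Obj} {p q n : ℤ} (h : q + p = n) (g : C.Hom Y Z q) (f : C.Hom X Y p),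
    map (C.comp h g f) = D.comp h (map g) (map f)

namespace DGFunctor

variable {k : Type w} [Field k] {C : DGCat.{w, u₁, v₁} k} {D : DGCat.{w, u₂, v₂} k}

/-- The action of a dg functor on cocycles. -/
def mapCocycles (F : DGFunctor C D) (X Y : C.Obj) (n : ℤ) :
    C.Cocycles X Y n →ₗ[k] D.Cocycles (F.obj X) (F.obj Y) n :=
  F.map.restrict fun x hx => by
    rw [LinearMap.mem_ker] at hx ⊢
    rw [← F.map_d, hx, map_zero]

/-- The action of a dg functor on the cohomology of Hom complexes. -/
def mapCohomology (F : DGFunctor C D) (X Y : C.Obj) (n : ℤ) :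
    C.Cohomology X Y n →ₗ[k] D.Cohomology (F.obj X) (F.obj Y) n :=
  Submodule.mapQ _ _ (F.mapCocycles X Y n) (by
    rintro ⟨x, hx⟩ ⟨y, hy⟩
    exact ⟨F.map y, by rw [← F.map_d, hy]; rfl⟩)

/-- A dg functor is a quasi-equivalence if it is a quasi-isomorphism on all Hom complexes and
the induced functor of homotopy categories is essentially surjective. -/
structure IsQuasiEquivalence (F : DGFunctor C D) : Prop where
  bijective_mapCohomology : ∀ (X Y : C.Obj) (n : ℤ), Function.Bijective (F.mapCohomology X Y n)
  essSurj : ∀ Z : D.Obj, ∃ X : C.Obj, D.HomotopyEquivalent (F.obj X) Z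

end DGFunctor

/-! ## The interval category -/

/-- The component of degree `m` of `I_n(i, j)`: it is `k` if `i ≤ j` and `m = 0`,
and `0` otherwise. -/
def intervalHom (k : Type w) [Field k] (n : ℕ) (i j : Fin (n + 1)) (m : ℤ) : Submodule k k where
  carrier := {a | ¬ (i ≤ j ∧ m = 0) → a = 0}
  add_mem' ha hb h := by rw [ha h, hb h, add_zero]
  zero_mem' _ := rfl
  smul_mem' c a ha h := by rw [ha h, smul_zero]

/-- The interval category `I_n` with objects `0, …, n`, as a dg category with zero differential;
the composition is the product of `k`. -/
def DGCat.interval (k : Type w) [Field k] (n : ℕ) : DGCat.{w, 0, w} k where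
  Obj := Fin (n + 1)
  Hom i j m := intervalHom k n i j m
  d _ _ _ := 0
  id i := ⟨1, fun h => absurd ⟨le_rfl, rfl⟩ h⟩
  comp {i j l p q m} h := LinearMap.mk₂ k
    (fun g f => ⟨g.1 * f.1, fun hm => by
      by_contra hne
      have hg : j ≤ l ∧ q = 0 := by
        by_contra hc
        exact hne (by rw [g.2 hc, zero_mul])
      have hf : i ≤ j ∧ p = 0 := by
        by_contra hc
        exact hne (by rw [f.2 hc, mul_zero])
      exact hm ⟨hf.1.trans hg.1, by omega⟩⟩)
    (fun _ _ _ => Subtype.ext (add_mul _ _ _))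
    (fun _ _ _ => Subtype.ext (mul_assoc _ _ _))
    (fun _ _ _ => Subtype.ext (mul_add _ _ _))
    (fun _ _ _ => Subtype.ext (mul_left_comm _ _ _))
  d_d _ _ _ := rfl
  id_comp _ _ := Subtype.ext (one_mul _)
  comp_id _ _ := Subtype.ext (mul_one _)
  assoc _ _ _ _ _ _ _ := Subtype.ext (mul_assoc _ _ _)
  leibniz _ _ _ _ _ _ _ _ := by
    simp only [LinearMap.zero_apply, map_zero, smul_zero, add_zero]

/-! ## The tensor product of dg categories -/

namespace DGCat

variable {k : Type w} [Field k]

section Tensor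

variable (C : DGCat.{w, u₁, v₁} k) (D : DGCat.{w, u₂, v₂} k)

/-- The degree `n` component `⨁_{p + q = n} C(X₁, Y₁)^p ⊗ D(X₂, Y₂)^q` of the tensor product of
the Hom complexes. -/
abbrev TensorHom (X Y : C.Obj × D.Obj) (n : ℤ) : Type (max v₁ v₂) :=
  DirectSum {pq : ℤ × ℤ // pq.1 + pq.2 = n} fun pq =>
    C.Hom X.1 Y.1 pq.1.1 ⊗[k] D.Hom X.2 Y.2 pq.1.2

variable {C D}

/-- The pure tensor `f ⊗ g`. -/
def tmul {X Y : C.Obj × D.Obj} {p q n : ℤ} (h : p + q = n) :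
    C.Hom X.1 Y.1 p →ₗ[k] D.Hom X.2 Y.2 q →ₗ[k] TensorHom C D X Y n :=
  (TensorProduct.mk k (C.Hom X.1 Y.1 p) (D.Hom X.2 Y.2 q)).compr₂
    (DirectSum.lof k {pq : ℤ × ℤ // pq.1 + pq.2 = n}
      (fun pq => C.Hom X.1 Y.1 pq.1.1 ⊗[k] D.Hom X.2 Y.2 pq.1.2) ⟨(p, q), h⟩)

/-- The linear map out of a Hom complex of the tensor product determined by its values on
pure tensors. -/
def tensorLift {X Y : C.Obj × D.Obj} {n : ℤ} {M : Type*} [AddCommGroup M] [Module k M]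
    (φ : ∀ p q : ℤ, p + q = n → (C.Hom X.1 Y.1 p →ₗ[k] D.Hom X.2 Y.2 q →ₗ[k] M)) :
    TensorHom C D X Y n →ₗ[k] M :=
  DirectSum.toModule k _ M fun pq => TensorProduct.lift (φ pq.1.1 pq.1.2 pq.2)

@[simp]
theorem tensorLift_tmul {X Y : C.Obj × D.Obj} {n : ℤ} {M : Type*} [AddCommGroup M] [Module k M]
    (φ : ∀ p q : ℤ, p + q = n → (C.Hom X.1 Y.1 p →ₗ[k] D.Hom X.2 Y.2 q →ₗ[k] M))
    {p q : ℤ} (h : p + q = n) (f : C.Hom X.1 Y.1 p) (g : D.Hom X.2 Y.2 q) :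
    tensorLift φ (tmul h f g) = φ p q h f g := by
  simp [tensorLift, tmul]

theorem tensorHom_induction {X Y : C.Obj × D.Obj} {n : ℤ} {P : TensorHom C D X Y n → Prop}
    (x : TensorHom C D X Y n) (zero : P 0) (add : ∀ a b, P a → P b → P (a + b))
    (tmul : ∀ (p q : ℤ) (h : p + q = n) (f : C.Hom X.1 Y.1 p) (g : D.Hom X.2 Y.2 q),
      P (tmul h f g)) : P x := by
  induction x using DirectSum.induction_on with
  | zero => exact zero
  | add a b ha hb => exact add a b ha hb
  | of i t =>
    obtain ⟨⟨p, q⟩, h⟩ := i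
    induction t using TensorProduct.induction_on with
    | zero => simpa using zero
    | add a b ha hb => simpa using add _ _ ha hb
    | tmul f g => exact tmul p q h f g

theorem tensorHom_ext {X Y : C.Obj × D.Obj} {n : ℤ} {M : Type*} [AddCommGroup M] [Module k M]
    {φ ψ : TensorHom C D X Y n →ₗ[k] M}
    (h : ∀ (p q : ℤ) (h : p + q = n) (f : C.Hom X.1 Y.1 p) (g : D.Hom X.2 Y.2 q),
      φ (tmul h f g) = ψ (tmul h f g)) : φ = ψ :=
  LinearMap.ext fun x => by
    induction x using tensorHom_induction with
    | zero => rw [map_zero, map_zero]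
    | add a b ha hb => rw [map_add, map_add, ha, hb]
    | tmul p q hpq f g => exact h p q hpq f g

/-- `d(f ⊗ g) = df ⊗ g + (-1)^{|f|} f ⊗ dg`. -/
def tensorD {X Y : C.Obj × D.Obj} (n m : ℤ) (h : n + 1 = m) :
    TensorHom C D X Y n →ₗ[k] TensorHom C D X Y m :=
  tensorLift fun p q hpq =>
    (tmul (by omega : (p + 1) + q = m)).comp (C.d p (p + 1) rfl) +
      sgn k p • (tmul (by omega : p + (q + 1) = m)).compl₂ (D.d q (q + 1) rfl)

theorem tensorD_tmul {X Y : C.Obj × D.Obj} {n m p q p' q' : ℤ} (h : n + 1 = m) (hpq : p + q = n)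
    (hp : p + 1 = p') (hq : q + 1 = q') (h₁ : p' + q = m) (h₂ : p + q' = m)
    (f : C.Hom X.1 Y.1 p) (g : D.Hom X.2 Y.2 q) :
    tensorD n m h (tmul hpq f g) =
      tmul h₁ (C.d p p' hp f) g + sgn k p • tmul h₂ f (D.d q q' hq g) := by
  subst hp hq
  simp [tensorD]

/-- `(f ⊗ g) ∘ (f' ⊗ g') = (-1)^{|g| |f'|} (f ∘ f') ⊗ (g ∘ g')`. -/
def tensorComp {X Y Z : C.Obj × D.Obj} {r s n : ℤ} (h : s + r = n) :
    TensorHom C D Y Z s →ₗ[k] TensorHom C D X Y r →ₗ[k] TensorHom C D X Z n :=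
  tensorLift fun p q hpq => LinearMap.mk₂ k
    (fun f g => tensorLift fun p' q' hpq' =>
      sgn k (q * p') • (tmul (by omega : (p + p') + (q + q') = n)).compl₁₂
        (C.comp rfl f) (D.comp rfl g))
    (fun _ _ _ => tensorHom_ext fun _ _ _ _ _ => by simp)
    (fun _ _ _ => tensorHom_ext fun _ _ _ _ _ => by
      simp only [tensorLift_tmul, map_smul, LinearMap.smul_apply, LinearMap.compl₁₂_apply]
      rw [smul_comm])
    (fun _ _ _ => tensorHom_ext fun _ _ _ _ _ => by simp)
    (fun _ _ _ => tensorHom_ext fun _ _ _ _ _ => by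
      simp only [tensorLift_tmul, map_smul, LinearMap.smul_apply, LinearMap.compl₁₂_apply]
      rw [smul_comm])

theorem tensorComp_tmul {X Y Z : C.Obj × D.Obj} {r s n p q p' q' pp qq : ℤ} (h : s + r = n)
    (hpq : p + q = s) (hpq' : p' + q' = r) (hp : p + p' = pp) (hq : q + q' = qq)
    (hn : pp + qq = n)
    (f : C.Hom Y.1 Z.1 p) (g : D.Hom Y.2 Z.2 q) (f' : C.Hom X.1 Y.1 p') (g' : D.Hom X.2 Y.2 q') :
    tensorComp h (tmul hpq f g) (tmul hpq' f' g') =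
      sgn k (q * p') • tmul hn (C.comp hp f f') (D.comp hq g g') := by
  subst hp hq
  simp [tensorComp]

variable (C D)

/-- The tensor product `C ⊗ D` of dg categories. -/
def tensor : DGCat.{w, max u₁ u₂, max v₁ v₂} k where
  Obj := C.Obj × D.Obj
  Hom X Y n := TensorHom C D X Y n
  d n m h := tensorD n m h
  id X := tmul (add_zero 0) (C.id X.1) (D.id X.2)
  comp h := tensorComp h
  d_d {X Y n m l} h h' x := by
    induction x using tensorHom_induction with
    | zero => simp
    | add a b ha hb => simp only [map_add, ha, hb, add_zero]
    | tmul p q hpq f g =>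
      rw [tensorD_tmul h hpq rfl rfl (by omega) (by omega), map_add, map_smul,
        tensorD_tmul h' _ rfl rfl (by omega) (by omega),
        tensorD_tmul h' _ rfl rfl (by omega) (by omega), C.d_d, D.d_d, sgn_add, sgn_one]
      simp only [map_zero, LinearMap.zero_apply, smul_zero, add_zero, zero_add, mul_neg, mul_one]
      rw [← add_smul, neg_add_cancel, zero_smul]
  id_comp {X Y n} h x := by
    induction x using tensorHom_induction with
    | zero => simp
    | add a b ha hb => simp only [map_add, ha, hb]
    | tmul p q hpq f g =>
      rw [tensorComp_tmul h _ hpq (zero_add p) (zero_add q) hpq, C.id_comp, D.id_comp,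
        zero_mul, sgn_zero, one_smul]
  comp_id {X Y n} h x := by
    induction x using tensorHom_induction with
    | zero => simp
    | add a b ha hb => simp only [map_add, LinearMap.add_apply, ha, hb]
    | tmul p q hpq f g =>
      rw [tensorComp_tmul h hpq _ (add_zero p) (add_zero q) hpq, C.comp_id, D.comp_id,
        mul_zero, sgn_zero, one_smul]
  assoc {W X Y Z p q r pq qr n} h₁ h₂ h₃ h₄ c b a := by
    induction c using tensorHom_induction with
    | zero => simp
    | add c c' hc hc' => simp only [map_add, LinearMap.add_apply, hc, hc']
    | tmul pc qc hpqc fc gc =>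
    induction b using tensorHom_induction with
    | zero => simp
    | add c c' hc hc' => simp only [map_add, LinearMap.add_apply, hc, hc']
    | tmul pb qb hpqb fb gb =>
    induction a using tensorHom_induction with
    | zero => simp
    | add c c' hc hc' => simp only [map_add, hc, hc']
    | tmul pa qa hpqa fa ga =>
      rw [tensorComp_tmul h₁ hpqc hpqb rfl rfl (by omega),
        tensorComp_tmul h₃ hpqb hpqa rfl rfl (by omega), map_smul, map_smul, LinearMap.smul_apply,
        tensorComp_tmul h₂ _ hpqa rfl rfl (by omega),
        tensorComp_tmul h₄ hpqc _ (by omega : pc + (pb + pa) = pc + pb + pa)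
          (by omega : qc + (qb + qa) = qc + qb + qa) (by omega),
        C.assoc rfl rfl rfl (by omega), D.assoc rfl rfl rfl (by omega),
        smul_smul, smul_smul, ← sgn_add, ← sgn_add]
      congr 2
      ring
  leibniz {X Y Z p q n m p' q'} h hn hp hq h₁ h₂ g f := by
    induction g using tensorHom_induction with
    | zero => simp
    | add c c' hc hc' =>
      simp only [map_add, LinearMap.add_apply, hc, hc', smul_add]
      abel
    | tmul pc qc hpqc fc gc =>
    induction f using tensorHom_induction with
    | zero => simp
    | add c c' hc hc' =>
      simp only [map_add, hc, hc', smul_add]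
      abel
    | tmul pb qb hpqb fb gb =>
      rw [tensorComp_tmul h hpqc hpqb rfl rfl (by omega), map_smul,
        tensorD_tmul hn _ rfl rfl (by omega) (by omega),
        tensorD_tmul hq hpqc rfl rfl (by omega) (by omega),
        tensorD_tmul hp hpqb rfl rfl (by omega) (by omega)]
      simp only [map_add, map_smul, LinearMap.add_apply, LinearMap.smul_apply]
      rw [tensorComp_tmul h₁ _ hpqb (by omega : pc + 1 + pb = pc + pb + 1) rfl (by omega),
        tensorComp_tmul h₁ _ hpqb rfl (by omega : qc + 1 + qb = qc + qb + 1) (by omega),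
        tensorComp_tmul h₂ hpqc _ (by omega : pc + (pb + 1) = pc + pb + 1) rfl (by omega),
        tensorComp_tmul h₂ hpqc _ rfl (by omega : qc + (qb + 1) = qc + qb + 1) (by omega),
        C.leibniz rfl rfl rfl rfl (by omega) (by omega),
        D.leibniz rfl rfl rfl rfl (by omega) (by omega)]
      simp only [map_add, map_smul, LinearMap.add_apply, LinearMap.smul_apply, smul_add, smul_smul]
      have e₀ : sgn k q = sgn k (pc + qc) := by rw [hpqc]
      have e₁ : sgn k (qc * pb) * sgn k pc = sgn k (pc + qc) * sgn k (qc * (pb + 1)) := by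
        rw [mul_add, mul_one, sgn_add, sgn_add]
        linear_combination (-sgn k (qc * pb) * sgn k pc) * sgn_mul_self k qc
      have e₂ : sgn k (qc * pb) * sgn k (pc + pb) = sgn k pc * sgn k ((qc + 1) * pb) := by
        rw [add_mul, one_mul, sgn_add, sgn_add]
        ring
      have e₃ : sgn k (qc * pb) * (sgn k (pc + pb) * sgn k qc) =
          sgn k (pc + qc) * (sgn k pb * sgn k (qc * pb)) := by
        rw [sgn_add, sgn_add]
        ring
      rw [e₀, e₁, e₂, e₃]
      abel

end Tensor

/-! ## The twisted tensor product -/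

section Twisted

variable (C : DGCat.{w, u₁, v₁} k) (D : DGCat.{w, u₂, v₂} k)

/-- Finite (possibly empty) chains `d₀ → d₁ → ⋯ → dₙ` of composable homogeneous morphisms of `D`.
A chain `g₁, …, gₙ` is written from left to right as `[gₙ | ⋯ | g₁]`, so that `cons g x` adds
`g` as the last morphism of the chain. -/
inductive Chain (D : DGCat.{w, u₂, v₂} k) (d₀ : D.Obj) : D.Obj → Type (max u₂ v₂)
  | nil : Chain D d₀ d₀
  | cons {d₁ d₂ : D.Obj} {p : ℤ} (g : D.Hom d₁ d₂ p) (x : Chain D d₀ d₁) : Chain D d₀ d₂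

namespace Chain

variable {D}

/-- The degree `∑ (|gⱼ| - 1)` of a chain. -/
def deg {d : D.Obj} : ∀ {d' : D.Obj}, Chain D d d' → ℤ
  | _, nil => 0
  | _, cons (p := p) _ x => (p - 1) + deg x

/-- Concatenation of chains: `y` comes after `x`. -/
def append {d d' : D.Obj} : ∀ {d'' : D.Obj}, Chain D d' d'' → Chain D d d' → Chain D d d''
  | _, nil, x => x
  | _, cons g y, x => cons g (append y x)

theorem deg_append {d d' : D.Obj} : ∀ {d'' : D.Obj} (y : Chain D d' d'') (x : Chain D d d'),
    (append y x).deg = y.deg + x.deg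
  | _, nil, x => by simp [append, deg]
  | _, cons g y, x => by simp [append, deg, deg_append y x, add_assoc]

/-- A way to cut the chain `x` into a final part `left` and an initial part `right`. -/
structure Split {d d' : D.Obj} (x : Chain D d d') where
  mid : D.Obj
  left : Chain D mid d'
  right : Chain D d mid
  eq : append left right = x

theorem Split.deg_eq {d d' : D.Obj} {x : Chain D d d'} (s : Split x) :
    s.left.deg + s.right.deg = x.deg := by
  rw [← deg_append, s.eq]

/-- All `n + 1` ways to cut a chain of length `n` in two. -/
def splits {d : D.Obj} : ∀ {d' : D.Obj} (x : Chain D d d'), List (Split x)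
  | _, nil => [⟨_, nil, nil, rfl⟩]
  | _, cons g x => ⟨_, nil, cons g x, rfl⟩ ::
      (splits x).map fun s => ⟨s.mid, cons g s.left, s.right, by rw [append, s.eq]⟩

/-- A nonempty chain written as a chain `init` after its initial morphism `first`. -/
structure Unsnoc {d d' : D.Obj} (x : Chain D d d') where
  mid : D.Obj
  q : ℤ
  init : Chain D mid d'
  first : D.Hom d mid q
  eq : append init (cons first nil) = x

theorem Unsnoc.deg_eq {d d' : D.Obj} {x : Chain D d d'} (s : Unsnoc x) :
    s.init.deg + s.q = x.deg + 1 := by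
  have h := congrArg deg s.eq
  rw [deg_append, deg, deg] at h
  omega

/-- The decomposition of the nonempty chain `[g | x]` into all morphisms but the first and the
first one. -/
def unsnoc {d : D.Obj} : ∀ {d₁ d₂ : D.Obj} {p : ℤ} (g : D.Hom d₁ d₂ p) (x : Chain D d d₁),
    Unsnoc (cons g x)
  | _, _, p, g, nil => ⟨_, p, nil, g, rfl⟩
  | _, _, _, g, cons g' x =>
    ⟨(unsnoc g' x).mid, (unsnoc g' x).q, cons g (unsnoc g' x).init, (unsnoc g' x).first,
      congrArg (cons g) (unsnoc g' x).eq⟩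

/-- The term `(-1)^{|g|} [g ∘ g' | x']` of the bar differential of `[g | g' | x']`. -/
def contract {d : D.Obj} : ∀ {d₁ d₂ : D.Obj} {p : ℤ} (g : D.Hom d₁ d₂ p) (x : Chain D d d₁),
    List (ℤ × {y : Chain D d d₂ // y.deg = (cons g x).deg + 1})
  | _, _, _, _, nil => []
  | _, _, p, g, cons g' x => [(p, ⟨cons (D.comp rfl g g') x, by simp only [deg]; ring⟩)]

/-- The differential of the bar construction, as the list of its terms; a pair `(s, y)` stands
for `(-1)^s y`. Explicitly, it is
`-∑ⱼ (-1)^{∑_{i>j} (|gᵢ| - 1)} [gₙ | ⋯ | dgⱼ | ⋯ | g₁] +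
  ∑ⱼ (-1)^{∑_{i>j+1} (|gᵢ| - 1) + |gⱼ₊₁|} [gₙ | ⋯ | gⱼ₊₁ ∘ gⱼ | ⋯ | g₁]`. -/
def bar {d : D.Obj} : ∀ {d' : D.Obj} (x : Chain D d d'),
    List (ℤ × {y : Chain D d d' // y.deg = x.deg + 1})
  | _, nil => []
  | _, cons (p := p) g x =>
    (1, ⟨cons (D.d p (p + 1) rfl g) x, by simp only [deg]; ring⟩) ::
      (contract g x ++
        (bar x).map fun t => ((p - 1) + t.1, ⟨cons g t.2.1, by simp only [deg, t.2.2]; ring⟩))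

end Chain

open Chain

/-- Formal expressions for the homogeneous morphisms of the graded `k`-linear category freely
generated by the morphisms `f ⊗ id`, `id ⊗ g` and `ε(f; g₁, …, gₙ)`, `n ≥ 1`.
`right c g` stands for `id_c ⊗ g`, and `eps f x _` stands for `ε(f; g₁, …, gₙ)` if `x` is the
chain `g₁, …, gₙ` with `n ≥ 1` and for `f ⊗ id_d` if `x` is the empty chain at `d`. The degree
of `ε(f; g₁, …, gₙ)` is `|f| + ∑ |gⱼ| - n`. -/
inductive Term : C.Obj × D.Obj → C.Obj × D.Obj → ℤ → Type (max w u₁ u₂ v₁ v₂)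
  | zero {X Y : C.Obj × D.Obj} {n : ℤ} : Term X Y n
  | add {X Y : C.Obj × D.Obj} {n : ℤ} (a b : Term X Y n) : Term X Y n
  | smul {X Y : C.Obj × D.Obj} {n : ℤ} (r : k) (a : Term X Y n) : Term X Y n
  | id (X : C.Obj × D.Obj) : Term X X 0
  | comp {X Y Z : C.Obj × D.Obj} {p q n : ℤ} (h : q + p = n) (b : Term Y Z q) (a : Term X Y p) :
      Term X Z n
  | right (c : C.Obj) {d d' : D.Obj} {n : ℤ} (g : D.Hom d d' n) : Term (c, d) (c, d') n
  | eps {c c' : C.Obj} {d d' : D.Obj} {p n : ℤ} (f : C.Hom c c' p) (x : Chain D d d')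
      (h : p + x.deg = n) : Term (c, d) (c', d') n

namespace Term

variable {C D}

/-- The sum of a list of expressions. -/
def sum {X Y : C.Obj × D.Obj} {n : ℤ} (l : List (Term C D X Y n)) : Term C D X Y n :=
  l.foldr add zero

/-- The differential of `ε(f; x)`, where `b` is the bar differential: it is `df ⊗ id` if `x` is
empty, and otherwise
`ε(df; x) + (-1)^{|f|} ε(f; b x) - (-1)^{|f| (|gₙ| - 1)} (id ⊗ gₙ) * ε(f; g₁, …, gₙ₋₁) +
  (-1)^{|f| + ∑_{i ≥ 2} (|gᵢ| - 1)} ε(f; g₂, …, gₙ) * (id ⊗ g₁)`. -/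
def epsD {c c' : C.Obj} {p : ℤ} (f : C.Hom c c' p) :
    ∀ {d d' : D.Obj} (x : Chain D d d') (m : ℤ), p + x.deg + 1 = m → Term C D (c, d) (c', d') m
  | _, _, .nil, m, h => eps (C.d p (p + 1) rfl f) .nil (by rw [deg] at h ⊢; omega)
  | _, _, .cons (p := q) g x, m, h =>
    sum [eps (C.d p (p + 1) rfl f) (.cons g x) (by omega),
      smul (sgn k p) (sum ((bar (.cons g x)).map fun t =>
        smul (sgn k t.1) (eps f t.2.1 (by rw [t.2.2]; omega)))),
      smul (-sgn k (p * (q - 1)))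
        (comp (by rw [deg] at h; omega : q + (p + x.deg) = m) (right c' g) (eps f x rfl)),
      smul (sgn k (p + (unsnoc g x).init.deg))
        (comp (by have := (unsnoc g x).deg_eq; omega : (p + (unsnoc g x).init.deg) +
            (unsnoc g x).q = m)
          (eps f (unsnoc g x).init rfl) (right c (unsnoc g x).first))]

/-- The differential on formal expressions: the derivation with the prescribed values on the
generators. -/
def d : ∀ {X Y : C.Obj × D.Obj} {n : ℤ}, Term C D X Y n → ∀ m : ℤ, n + 1 = m → Term C D X Y m
  | _, _, _, zero, _, _ => zero
  | _, _, _, add a b, m, h => add (d a m h) (d b m h)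
  | _, _, _, smul r a, m, h => smul r (d a m h)
  | _, _, _, id _, _, _ => zero
  | _, _, _, comp (p := p) (q := q) h' b a, m, h =>
    add (comp (by omega : (q + 1) + p = m) (d b (q + 1) rfl) a)
      (smul (sgn k q) (comp (by omega : q + (p + 1) = m) b (d a (p + 1) rfl)))
  | _, _, n, right c g, m, h => right c (D.d n m h g)
  | _, _, _, eps f x h', m, h => epsD f x m (by omega)

/-- The congruence on formal expressions that defines the twisted tensor product: it is
generated by the axioms of a graded `k`-linear category, by the relations between the generators,
and it is closed under the differential, that is, it is given by a two-sided dg ideal. -/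
inductive Rel : ∀ {X Y : C.Obj × D.Obj} {n : ℤ}, Term C D X Y n → Term C D X Y n → Prop
  -- it is an equivalence relation
  | refl {X Y : C.Obj × D.Obj} {n : ℤ} (a : Term C D X Y n) : Rel a a
  | symm {X Y : C.Obj × D.Obj} {n : ℤ} {a b : Term C D X Y n} : Rel a b → Rel b a
  | trans {X Y : C.Obj × D.Obj} {n : ℤ} {a b c : Term C D X Y n} : Rel a b → Rel b c → Rel a c
  -- it is compatible with the operations
  | add_congr {X Y : C.Obj × D.Obj} {n : ℤ} {a a' b b' : Term C D X Y n} :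
      Rel a a' → Rel b b' → Rel (add a b) (add a' b')
  | smul_congr {X Y : C.Obj × D.Obj} {n : ℤ} (r : k) {a a' : Term C D X Y n} :
      Rel a a' → Rel (smul r a) (smul r a')
  | comp_congr {X Y Z : C.Obj × D.Obj} {p q n : ℤ} (h : q + p = n) {b b' : Term C D Y Z q}
      {a a' : Term C D X Y p} : Rel b b' → Rel a a' → Rel (comp h b a) (comp h b' a')
  | d_congr {X Y : C.Obj × D.Obj} {n m : ℤ} (h : n + 1 = m) {a a' : Term C D X Y n} :
      Rel a a' → Rel (d a m h) (d a' m h)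
  -- vector spaces
  | add_assoc {X Y : C.Obj × D.Obj} {n : ℤ} (a b c : Term C D X Y n) :
      Rel (add (add a b) c) (add a (add b c))
  | add_comm {X Y : C.Obj × D.Obj} {n : ℤ} (a b : Term C D X Y n) : Rel (add a b) (add b a)
  | add_zero {X Y : C.Obj × D.Obj} {n : ℤ} (a : Term C D X Y n) : Rel (add a zero) a
  | zero_smul {X Y : C.Obj × D.Obj} {n : ℤ} (a : Term C D X Y n) : Rel (smul 0 a) zero
  | one_smul {X Y : C.Obj × D.Obj} {n : ℤ} (a : Term C D X Y n) : Rel (smul 1 a) a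
  | mul_smul {X Y : C.Obj × D.Obj} {n : ℤ} (r s : k) (a : Term C D X Y n) :
      Rel (smul (r * s) a) (smul r (smul s a))
  | smul_add {X Y : C.Obj × D.Obj} {n : ℤ} (r : k) (a b : Term C D X Y n) :
      Rel (smul r (add a b)) (add (smul r a) (smul r b))
  | add_smul {X Y : C.Obj × D.Obj} {n : ℤ} (r s : k) (a : Term C D X Y n) :
      Rel (smul (r + s) a) (add (smul r a) (smul s a))
  -- a category with bilinear composition
  | id_comp {X Y : C.Obj × D.Obj} {n : ℤ} (h : 0 + n = n) (a : Term C D X Y n) :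
      Rel (comp h (id Y) a) a
  | comp_id {X Y : C.Obj × D.Obj} {n : ℤ} (h : n + 0 = n) (a : Term C D X Y n) :
      Rel (comp h a (id X)) a
  | assoc {W X Y Z : C.Obj × D.Obj} {p q r pq qr n : ℤ} (h₁ : r + q = qr) (h₂ : qr + p = n)
      (h₃ : q + p = pq) (h₄ : r + pq = n) (c : Term C D Y Z r) (b : Term C D X Y q)
      (a : Term C D W X p) : Rel (comp h₂ (comp h₁ c b) a) (comp h₄ c (comp h₃ b a))
  | add_comp {X Y Z : C.Obj × D.Obj} {p q n : ℤ} (h : q + p = n) (b b' : Term C D Y Z q)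
      (a : Term C D X Y p) : Rel (comp h (add b b') a) (add (comp h b a) (comp h b' a))
  | smul_comp {X Y Z : C.Obj × D.Obj} {p q n : ℤ} (h : q + p = n) (r : k) (b : Term C D Y Z q)
      (a : Term C D X Y p) : Rel (comp h (smul r b) a) (smul r (comp h b a))
  | comp_add {X Y Z : C.Obj × D.Obj} {p q n : ℤ} (h : q + p = n) (b : Term C D Y Z q)
      (a a' : Term C D X Y p) : Rel (comp h b (add a a')) (add (comp h b a) (comp h b a'))
  | comp_smul {X Y Z : C.Obj × D.Obj} {p q n : ℤ} (h : q + p = n) (r : k) (b : Term C D Y Z q)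
      (a : Term C D X Y p) : Rel (comp h b (smul r a)) (smul r (comp h b a))
  -- the differential has square zero
  | d_d {X Y : C.Obj × D.Obj} {n m l : ℤ} (h : n + 1 = m) (h' : m + 1 = l)
      (a : Term C D X Y n) : Rel (d (d a m h) l h') zero
  -- `g ↦ id_c ⊗ g` is linear and multiplicative
  | right_add (c : C.Obj) {d d' : D.Obj} {n : ℤ} (g g' : D.Hom d d' n) :
      Rel (right c (g + g')) (add (right c g) (right c g'))
  | right_smul (c : C.Obj) {d d' : D.Obj} {n : ℤ} (r : k) (g : D.Hom d d' n) :
      Rel (right c (r • g)) (smul r (right c g))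
  | right_comp (c : C.Obj) {d₀ d₁ d₂ : D.Obj} {p q n : ℤ} (h : q + p = n) (g₂ : D.Hom d₁ d₂ q)
      (g₁ : D.Hom d₀ d₁ p) :
      Rel (right c (D.comp h g₂ g₁)) (comp h (right c g₂) (right c g₁))
  -- `f ⊗ id` and `ε(f; g₁, …, gₙ)` are linear in each argument
  | eps_add {c c' : C.Obj} {d d' : D.Obj} {p n : ℤ} (f f' : C.Hom c c' p) (x : Chain D d d')
      (h : p + x.deg = n) : Rel (eps (f + f') x h) (add (eps f x h) (eps f' x h))
  | eps_smul {c c' : C.Obj} {d d' : D.Obj} {p n : ℤ} (r : k) (f : C.Hom c c' p)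
      (x : Chain D d d') (h : p + x.deg = n) : Rel (eps (r • f) x h) (smul r (eps f x h))
  | eps_chain_add {c c' : C.Obj} {d₀ d₁ d₂ d₃ : D.Obj} {p q n : ℤ} (f : C.Hom c c' p)
      (y : Chain D d₂ d₃) (g g' : D.Hom d₁ d₂ q) (x : Chain D d₀ d₁)
      (h₁ : p + (append y (cons (g + g') x)).deg = n) (h₂ : p + (append y (cons g x)).deg = n)
      (h₃ : p + (append y (cons g' x)).deg = n) :
      Rel (eps f (append y (cons (g + g') x)) h₁)
        (add (eps f (append y (cons g x)) h₂) (eps f (append y (cons g' x)) h₃))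
  | eps_chain_smul {c c' : C.Obj} {d₀ d₁ d₂ d₃ : D.Obj} {p q n : ℤ} (f : C.Hom c c' p) (r : k)
      (y : Chain D d₂ d₃) (g : D.Hom d₁ d₂ q) (x : Chain D d₀ d₁)
      (h₁ : p + (append y (cons (r • g) x)).deg = n) (h₂ : p + (append y (cons g x)).deg = n) :
      Rel (eps f (append y (cons (r • g) x)) h₁) (smul r (eps f (append y (cons g x)) h₂))
  -- `ε` vanishes if one of its arguments is an identity morphism
  | eps_chain_id {c c' : C.Obj} {d₀ d₁ d₂ : D.Obj} {p n : ℤ} (f : C.Hom c c' p)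
      (y : Chain D d₁ d₂) (x : Chain D d₀ d₁)
      (h : p + (append y (cons (D.id d₁) x)).deg = n) :
      Rel (eps f (append y (cons (D.id d₁) x)) h) zero
  | eps_id (c : C.Obj) {d₀ d₁ d₂ : D.Obj} {q n : ℤ} (g : D.Hom d₁ d₂ q) (x : Chain D d₀ d₁)
      (h : 0 + (cons g x).deg = n) : Rel (eps (C.id c) (cons g x) h) zero
  -- `ε(f₂ ∘ f₁; x) = ∑ (-1)^{|f₁| |y|} ε(f₂; y) * ε(f₁; z)` over all ways to cut the chain `x`
  -- into a final part `y` and an initial part `z`; for the empty chain this is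
  -- `(f₂ ∘ f₁) ⊗ id = (f₂ ⊗ id) * (f₁ ⊗ id)`
  | eps_comp {c₀ c₁ c₂ : C.Obj} {d d' : D.Obj} {p₁ p₂ p n : ℤ} (hp : p₂ + p₁ = p)
      (f₂ : C.Hom c₁ c₂ p₂) (f₁ : C.Hom c₀ c₁ p₁) (x : Chain D d d') (h : p + x.deg = n) :
      Rel (eps (C.comp hp f₂ f₁) x h)
        (sum ((splits x).map fun s => smul (sgn k (p₁ * s.left.deg))
          (comp (by have := s.deg_eq; omega : (p₂ + s.left.deg) + (p₁ + s.right.deg) = n)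
            (eps f₂ s.left rfl) (eps f₁ s.right rfl))))
  -- `id_c ⊗ id_d` is the identity
  | right_id (c : C.Obj) (d : D.Obj) : Rel (right c (D.id d)) (id (c, d))
  | eps_id_nil (c : C.Obj) (d : D.Obj) (h : 0 + (Chain.nil (d₀ := d)).deg = 0) :
      Rel (eps (C.id c) (Chain.nil (d₀ := d)) h) (id (c, d))

variable (C D) in
/-- Expressions up to the congruence. -/
instance setoid (X Y : C.Obj × D.Obj) (n : ℤ) : Setoid (Term C D X Y n) where
  r := Rel
  iseqv := ⟨Rel.refl, Rel.symm, Rel.trans⟩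

end Term

/-- The degree `n` component of a Hom complex of the twisted tensor product. -/
def TwistedHom (X Y : C.Obj × D.Obj) (n : ℤ) : Type (max w u₁ u₂ v₁ v₂) :=
  Quotient (Term.setoid C D X Y n)

namespace TwistedHom

variable {C D} {X Y Z : C.Obj × D.Obj} {n : ℤ}

/-- The morphism given by an expression. -/
def mk (a : Term C D X Y n) : TwistedHom C D X Y n := Quotient.mk _ a

theorem sound {a b : Term C D X Y n} (h : Term.Rel a b) : mk a = mk b := Quotient.sound h

theorem ind {P : TwistedHom C D X Y n → Prop} (h : ∀ a, P (mk a)) (x) : P x :=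
  Quotient.ind h x

instance : Zero (TwistedHom C D X Y n) := ⟨mk .zero⟩

instance : Add (TwistedHom C D X Y n) :=
  ⟨Quotient.map₂ Term.add fun _ _ h _ _ h' => Term.Rel.add_congr h h'⟩

instance : SMul k (TwistedHom C D X Y n) :=
  ⟨fun r => Quotient.map (Term.smul r) fun _ _ h => Term.Rel.smul_congr r h⟩

instance : Neg (TwistedHom C D X Y n) := ⟨fun x => (-1 : k) • x⟩

theorem mk_zero : mk (.zero : Term C D X Y n) = 0 := rfl

theorem mk_add (a b : Term C D X Y n) : mk (a.add b) = mk a + mk b := rfl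

theorem mk_smul (r : k) (a : Term C D X Y n) : mk (a.smul r) = r • mk a := rfl

instance : AddCommGroup (TwistedHom C D X Y n) where
  add_assoc a b c := by
    induction a using ind with | _ a
    induction b using ind with | _ b
    induction c using ind with | _ c
    exact sound (.add_assoc a b c)
  add_comm a b := by
    induction a using ind with | _ a
    induction b using ind with | _ b
    exact sound (.add_comm a b)
  zero_add a := by
    induction a using ind with | _ a
    exact sound ((Term.Rel.add_comm _ a).trans (.add_zero a))
  add_zero a := by
    induction a using ind with | _ a
    exact sound (.add_zero a)
  neg_add_cancel a := by
    induction a using ind with | _ a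
    refine sound (a := ((a.smul (-1)).add a)) (((Term.Rel.add_congr (.refl _)
      (Term.Rel.one_smul a).symm).trans (Term.Rel.add_smul (-1) 1 a).symm).trans ?_)
    rw [neg_add_cancel]
    exact .zero_smul a
  nsmul := nsmulRec
  zsmul := zsmulRec

instance : Module k (TwistedHom C D X Y n) where
  one_smul a := by
    induction a using ind with | _ a
    exact sound (.one_smul a)
  mul_smul r s a := by
    induction a using ind with | _ a
    exact sound (.mul_smul r s a)
  smul_zero r := by
    refine sound (((Term.Rel.smul_congr r (Term.Rel.zero_smul .zero).symm).trans
      (Term.Rel.mul_smul r 0 _).symm).trans ?_)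
    rw [mul_zero]
    exact .zero_smul _
  smul_add r a b := by
    induction a using ind with | _ a
    induction b using ind with | _ b
    exact sound (.smul_add r a b)
  add_smul r s a := by
    induction a using ind with | _ a
    exact sound (.add_smul r s a)
  zero_smul a := by
    induction a using ind with | _ a
    exact sound (.zero_smul a)

end TwistedHom

open TwistedHom

/-- The twisted tensor product `C ⊗̃ D` of dg categories. -/
def twisted : DGCat.{w, max u₁ u₂, max w u₁ u₂ v₁ v₂} k where
  Obj := C.Obj × D.Obj
  Hom X Y n := TwistedHom C D X Y n
  d n m h :=
    { toFun := Quotient.map (fun a => Term.d a m h) fun _ _ r => Term.Rel.d_congr h r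
      map_add' := fun a b => by
        induction a using ind with | _ a
        induction b using ind with | _ b
        rfl
      map_smul' := fun r a => by
        induction a using ind with | _ a
        rfl }
  id X := TwistedHom.mk (Term.id X)
  comp h := LinearMap.mk₂ k
    (Quotient.map₂ (Term.comp h) fun _ _ r _ _ r' => Term.Rel.comp_congr h r r')
    (fun a b c => by
      induction a using ind with | _ a
      induction b using ind with | _ b
      induction c using ind with | _ c
      exact sound (.add_comp h a b c))
    (fun r a b => by
      induction a using ind with | _ a
      induction b using ind with | _ b
      exact sound (.smul_comp h r a b))
    (fun a b c => by
      induction a using ind with | _ a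
      induction b using ind with | _ b
      induction c using ind with | _ c
      exact sound (.comp_add h a b c))
    (fun r a b => by
      induction a using ind with | _ a
      induction b using ind with | _ b
      exact sound (.comp_smul h r a b))
  d_d h h' a := by
    induction a using ind with | _ a
    exact sound (.d_d h h' a)
  id_comp h a := by
    induction a using ind with | _ a
    exact sound (.id_comp h a)
  comp_id h a := by
    induction a using ind with | _ a
    exact sound (.comp_id h a)
  assoc h₁ h₂ h₃ h₄ c b a := by
    induction a using ind with | _ a
    induction b using ind with | _ b
    induction c using ind with | _ c
    exact sound (.assoc h₁ h₂ h₃ h₄ c b a)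
  leibniz h hn hp hq h₁ h₂ b a := by
    subst hp hq
    induction a using ind with | _ a
    induction b using ind with | _ b
    rfl

/-! ## The projection to the tensor product -/

namespace Term

variable {C D}

/-- The value of an expression in `C ⊗ D`: it sends `f ⊗ id` and `id ⊗ g` to the morphisms with
the same name, and `ε(f; g₁, …, gₙ)` with `n ≥ 1` to `0`. -/
def eval : ∀ {X Y : C.Obj × D.Obj} {n : ℤ}, Term C D X Y n → TensorHom C D X Y n
  | _, _, _, zero => 0
  | _, _, _, add a b => eval a + eval b
  | _, _, _, smul r a => r • eval a
  | _, _, _, id X => tmul (add_zero 0) (C.id X.1) (D.id X.2)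
  | _, _, _, comp h b a => tensorComp h (eval b) (eval a)
  | _, _, n, right (d := d) (d' := d') c g =>
    tmul (X := (c, d)) (Y := (c, d')) (zero_add n) (C.id c) g
  | _, _, _, eps (c := c) (c' := c') (d := d) f .nil h =>
    tmul (X := (c, d)) (Y := (c', d)) (q := 0) (by rw [deg] at h; exact h) f (D.id d)
  | _, _, _, eps _ (.cons _ _) _ => 0

theorem eval_sum {X Y : C.Obj × D.Obj} {n : ℤ} (l : List (Term C D X Y n)) :
    eval (sum l) = (l.map eval).sum := by
  induction l with
  | nil => rfl
  | cons a l ih => simp [sum, eval, ← ih]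

theorem eval_sum_eq_zero {X Y : C.Obj × D.Obj} {n : ℤ} (l : List (Term C D X Y n))
    (hl : ∀ a ∈ l, eval a = 0) : eval (sum l) = 0 := by
  rw [eval_sum]
  exact List.sum_eq_zero (by simpa using hl)

theorem eval_eps_bar {c c' : C.Obj} {d₀ d₁ d₂ : D.Obj} {p q n : ℤ} (f : C.Hom c c' p)
    (g : D.Hom d₁ d₂ q) (x : Chain D d₀ d₁) (t) (ht : t ∈ bar (.cons g x))
    (h : p + t.2.1.deg = n) : eval (eps f t.2.1 h) = 0 := by
  simp only [bar, List.mem_cons, List.mem_append, List.mem_map] at ht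
  obtain rfl | ht | ⟨t, -, rfl⟩ := ht
  · rfl
  · cases x with
    | nil => simp [contract] at ht
    | cons g' x =>
      simp only [contract, List.mem_singleton] at ht
      subst ht
      rfl
  · rfl

theorem commutator_aux {c c' : C.Obj} {e e' : D.Obj} {p q r m : ℤ} (f : C.Hom c c' p)
    (g : D.Hom e e' q) (hr : p + 0 = r) (h₁ : q + r = m) (h₂ : r + q = m) :
    -sgn k (p * (q - 1)) • tensorComp (X := (c, e)) (Y := (c', e)) (Z := (c', e')) h₁
        (tmul (zero_add q) (C.id c') g) (tmul hr f (D.id e)) +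
      sgn k (p + 0) • tensorComp (X := (c, e)) (Y := (c, e')) (Z := (c', e')) h₂
        (tmul hr f (D.id e')) (tmul (zero_add q) (C.id c) g) = 0 := by
  rw [tensorComp_tmul _ _ _ (zero_add p) (add_zero q) (by omega),
    tensorComp_tmul _ _ _ (add_zero p) (zero_add q) (by omega),
    C.id_comp, D.comp_id, C.comp_id, D.id_comp, smul_smul, smul_smul, ← add_smul]
  refine (congrArg (· • _) ?_).trans (zero_smul _ _)
  have h : sgn k (p * q) = sgn k (p * (q - 1)) * sgn k p := by
    rw [← sgn_add]
    congr 1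
    ring
  rw [mul_comm q p, h, add_zero, zero_mul, sgn_zero]
  linear_combination (-sgn k p) * sgn_mul_self k (p * (q - 1))

theorem eval_epsD {c c' : C.Obj} {d₀ d₁ : D.Obj} {p m : ℤ} (f : C.Hom c c' p)
    (x : Chain D d₀ d₁) (h : p + x.deg + 1 = m) :
    eval (epsD f x m h) = tensorD (p + x.deg) m h (eval (eps f x rfl)) := by
  cases x with
  | nil =>
    refine Eq.trans ?_ (tensorD_tmul h _ rfl rfl ?_ ?_ _ _).symm
    · rw [D.d_id, map_zero, smul_zero, add_zero]
      rfl
    · rw [← h, deg]; ring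
  | @cons d₂ _ q g x =>
    refine Eq.trans ?_ (map_zero _).symm
    have hb : eval (sum ((bar (.cons g x)).map fun t => smul (sgn k t.1)
        (eps f t.2.1 (by rw [t.2.2]; omega) : Term C D (c, d₀) (c', d₁) m))) = 0 := by
      apply eval_sum_eq_zero
      simp only [List.mem_map]
      rintro _ ⟨t, ht, rfl⟩
      rw [eval, eval_eps_bar f g x t ht, smul_zero]
    rw [epsD, eval_sum]
    simp only [List.map_cons, List.map_nil, List.sum_cons, List.sum_nil, add_zero]
    rw [eval, eval, hb, smul_zero, zero_add]
    refine (zero_add _).trans ?_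
    cases x with
    | nil => exact commutator_aux f g rfl _ _
    | cons g' x =>
      refine (congrArg₂ (· + ·) (?_ : _ = (0 : TensorHom C D (c, d₀) (c', d₁) m))
        (?_ : _ = (0 : TensorHom C D (c, d₀) (c', d₁) m))).trans (add_zero _)
      · exact (congrArg _ (map_zero (tensorComp _ _))).trans (smul_zero _)
      · exact (congrArg _ (LinearMap.map_zero₂ (tensorComp _) _)).trans (smul_zero _)

theorem eval_d : ∀ {X Y : C.Obj × D.Obj} {n : ℤ} (a : Term C D X Y n) (m : ℤ) (h : n + 1 = m),
    eval (d a m h) = tensorD n m h (eval a)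
  | _, _, _, zero, _, _ => (map_zero _).symm
  | _, _, _, add a b, m, h => by
    simp only [d, eval, map_add, eval_d a, eval_d b]
  | _, _, _, smul r a, m, h => by
    simp only [d, eval, map_smul, eval_d a]
  | _, _, _, id X, m, h => ((tensor C D).d_id X m h).symm
  | _, _, _, comp (p := p) (q := q) h' b a, m, h => by
    simp only [d, eval, eval_d a, eval_d b]
    exact ((tensor C D).leibniz h' h rfl rfl (by omega) (by omega) (eval b) (eval a)).symm
  | _, _, n, right c g, m, h => by
    refine Eq.trans ?_ (tensorD_tmul h (zero_add n) rfl h (by omega) (zero_add m) _ _).symm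
    rw [C.d_id, map_zero, LinearMap.zero_apply, zero_add, sgn_zero, one_smul]
    rfl
  | _, _, _, eps f x rfl, m, h => eval_epsD f x h

theorem eval_eq_of_rel {X Y : C.Obj × D.Obj} {n : ℤ} {a b : Term C D X Y n} (h : Rel a b) :
    eval a = eval b := by
  induction h with
  | refl => rfl
  | symm _ ih => exact ih.symm
  | trans _ _ ih₁ ih₂ => exact ih₁.trans ih₂
  | add_congr _ _ ih₁ ih₂ => simp only [eval, ih₁, ih₂]
  | smul_congr _ _ ih => simp only [eval, ih]
  | comp_congr _ _ _ ih₁ ih₂ => simp only [eval, ih₁, ih₂]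
  | d_congr _ _ ih => rw [eval_d, eval_d, ih]
  | add_assoc => exact _root_.add_assoc _ _ _
  | add_comm => exact _root_.add_comm _ _
  | add_zero => exact _root_.add_zero _
  | zero_smul => exact _root_.zero_smul _ _
  | one_smul => exact _root_.one_smul _ _
  | mul_smul => exact SemigroupAction.mul_smul _ _ _
  | smul_add => exact _root_.smul_add _ _ _
  | add_smul => exact _root_.add_smul _ _ _
  | id_comp h a => exact (tensor C D).id_comp h _
  | comp_id h a => exact (tensor C D).comp_id h _
  | assoc h₁ h₂ h₃ h₄ => exact (tensor C D).assoc h₁ h₂ h₃ h₄ _ _ _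
  | add_comp => simp only [eval, map_add, LinearMap.add_apply]
  | smul_comp => simp only [eval, map_smul, LinearMap.smul_apply]
  | comp_add => simp only [eval, map_add]
  | comp_smul => simp only [eval, map_smul]
  | d_d h h' a =>
    rw [eval_d, eval_d]
    exact (tensor C D).d_d h h' _
  | right_add => simp only [eval, map_add]
  | right_smul => simp only [eval, map_smul]
  | right_comp c h g₂ g₁ =>
    refine Eq.trans ?_ (tensorComp_tmul h _ _ (add_zero 0) h (zero_add _) _ _ _ _).symm
    rw [C.id_comp, mul_zero, sgn_zero, _root_.one_smul]
    rfl
  | eps_add f f' x h =>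
    cases x with
    | nil => simp only [eval, map_add, LinearMap.add_apply]
    | cons g x => exact (_root_.add_zero _).symm
  | eps_smul r f x h =>
    cases x with
    | nil => simp only [eval, map_smul, LinearMap.smul_apply]
    | cons g x => exact (_root_.smul_zero _).symm
  | eps_chain_add f y => cases y <;> exact (_root_.add_zero _).symm
  | eps_chain_smul f r y => cases y <;> exact (_root_.smul_zero _).symm
  | eps_chain_id f y => cases y <;> rfl
  | eps_id => rfl
  | eps_comp hp f₂ f₁ x h =>
    cases x with
    | nil =>
      rw [eval_sum]
      simp only [splits, List.map_cons, List.map_nil, List.sum_cons, List.sum_nil,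
        _root_.add_zero, eval]
      rw [tensorComp_tmul _ _ _ hp (_root_.add_zero 0) (by rw [deg] at h; exact h), D.id_comp]
      simp [deg, sgn_zero]
    | cons g x =>
      refine Eq.trans ?_ (eval_sum_eq_zero _ ?_).symm
      · rfl
      simp only [splits, List.map_cons, List.map_map, List.mem_cons, List.mem_map]
      rintro _ (rfl | ⟨s, -, rfl⟩) <;> simp [eval]
  | right_id => rfl
  | eps_id_nil => rfl

end Term

variable {C D} in
/-- The projection on Hom complexes. -/
def projectionMap {X Y : C.Obj × D.Obj} {n : ℤ} :
    TwistedHom C D X Y n →ₗ[k] TensorHom C D X Y n where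
  toFun := Quotient.lift Term.eval fun _ _ h => Term.eval_eq_of_rel h
  map_add' a b := by
    induction a using ind with | _ a
    induction b using ind with | _ b
    rfl
  map_smul' r a := by
    induction a using ind with | _ a
    rfl

/-- The natural projection `C ⊗̃ D ⥤ C ⊗ D`: it is the identity on objects, sends `f ⊗ id` and
`id ⊗ g` to the morphisms with the same name, and all `ε(f; g₁, …, gₙ)` with `n ≥ 1` to `0`. -/
def projection : DGFunctor (twisted C D) (tensor C D) where
  obj X := X
  map {X Y n} := projectionMap (X := X) (Y := Y) (n := n)
  map_d h a := by
    induction a using ind with | _ a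
    exact Term.eval_d a _ h
  map_id X := rfl
  map_comp h b a := by
    induction a using ind with | _ a
    induction b using ind with | _ b
    rfl

end Twisted

end DGCat

end

/-!
# The twisted tensor product is quasi-equivalent to the tensor product

The projection `p : C ⊗̃ D → C ⊗ D` is a quasi-equivalence for *all* dg categories `C` and `D`; the
case of an interval category is a special one. No description of the Hom complexes of `C ⊗̃ D` by
a basis of words is needed.

On each Hom complex, `p` has the section `s(f ⊗ g) = (-1)^{|f| |g|} (id ⊗ g) (f ⊗ id)`
(`TwistedHom.ofTensor`), which commutes with the differentials. It remains to contract `C ⊗̃ D`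
to the image of `s`. Since `s` is not a functor, a contracting homotopy cannot be defined on
composites from its values on the factors alone; it needs a second argument. For a morphism
`a : X → Y` of `C ⊗̃ D` and a morphism `t : W → X` of `C ⊗ D`, there is `H(a; t) : W → Y` in
`C ⊗̃ D`, of degree `|a| + |t| - 1`, such that

* `H(b a; t) = H(b; p(a) t) + (-1)^{|b|} b H(a; t)`,
* `H(id ⊗ g'; t) = 0`,
* `H(ε(f'; g₁, …, gₙ); f ⊗ g) = ± ε(f'; g, g₁, …, gₙ) (f ⊗ id)` for `n ≥ 0`.

The first rule is that of a derivation, so that these rules define `H` on formal expressions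
(`TwistedHom.homotopy`). The identity
`d H(a; t) + H(da; t) + (-1)^{|a|} H(a; dt) = a s(t) - s(p(a) t)` (`TwistedHom.d_homotopy`) is
compatible with composites, so it only has to be checked on generators; there it is the formula for
`d ε(f'; g, g₁, …, gₙ)`, whose term `ε(f'; g₁, …, gₙ) (id ⊗ g)` is `a s(t)`. That `H` respects the
relations (`TwistedHom.homotopy_congr`) is clear except for three of them: for the differential of a
relation and for `d² = 0` it follows from that identity, and for the expansion of
`ε(f₂ f₁; g₁, …, gₙ)` it is the expansion of `ε(f₂ f₁; g, g₁, …, gₙ)`: its summands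
`ε(f₂; gₘ₊₁, …, gₙ) ε(f₁; g, g₁, …, gₘ)` are the terms `b H(a; t)`, and its summand
`ε(f₂; g, g₁, …, gₙ) (f₁ ⊗ id)` is the only nonzero term `H(b; p(a) t)`, that for `a = f₁ ⊗ id`.

For `t = id` the identity shows that a cocycle `a` is cohomologous to `s(p(a))`.
-/

noncomputable section

/-! ### Signs -/

theorem sgn_congr (k : Type w) [Field k] {m n : ℤ} (c : ℤ) (h : m = n + 2 * c) :
    sgn k m = sgn k n := by
  rw [h, two_mul, sgn_add, sgn_add, sgn_mul_self, mul_one]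

theorem sgn_sub (k : Type w) [Field k] (m n : ℤ) : sgn k (m - n) = sgn k m * sgn k n := by
  rw [sgn_congr k (n := m + n) (-n) (by ring), sgn_add]

namespace DGCat

variable {k : Type w} [Field k] {C : DGCat.{w, u₁, v₁} k} {D : DGCat.{w, u₂, v₂} k}

/-! ### Chains -/

namespace Chain

/-- The chain `[gₙ | ⋯ | g₁ | g]`, in which `g` is put before the chain `x = [gₙ | ⋯ | g₁]` as its
new first morphism. -/
def snoc {d₀ d₁ d₂ : D.Obj} {q : ℤ} (x : Chain D d₁ d₂) (g : D.Hom d₀ d₁ q) : Chain D d₀ d₂ :=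
  append x (cons g nil)

theorem deg_snoc {d₀ d₁ d₂ : D.Obj} {q : ℤ} (x : Chain D d₁ d₂) (g : D.Hom d₀ d₁ q) :
    (x.snoc g).deg = x.deg + q - 1 := by
  simp only [snoc, deg_append, deg]
  ring

theorem append_append {d₀ d₁ d₂ : D.Obj} : ∀ {d₃ : D.Obj} (z : Chain D d₂ d₃)
    (y : Chain D d₁ d₂) (x : Chain D d₀ d₁), append (append z y) x = append z (append y x)
  | _, nil, _, _ => rfl
  | _, cons g z, y, x => congrArg (cons g) (append_append z y x)

theorem snoc_append {d₀ d₁ d₂ d₃ d₄ : D.Obj} {p q : ℤ} (y : Chain D d₃ d₄) (g : D.Hom d₂ d₃ p)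
    (x : Chain D d₁ d₂) (g' : D.Hom d₀ d₁ q) :
    (append y (cons g x)).snoc g' = append y (cons g (x.snoc g')) :=
  append_append _ _ _

/-- The first morphism of `[x | g]` is `g`, if `x = [g' | ⋯]` is nonempty. -/
theorem unsnoc_snoc {d₀ d₁ : D.Obj} {q : ℤ} (g : D.Hom d₀ d₁ q) : ∀ {d₂ d₃ : D.Obj} {p : ℤ}
    (g' : D.Hom d₂ d₃ p) (x : Chain D d₁ d₂),
    unsnoc g' (x.snoc g) = ⟨d₁, q, cons g' x, g, rfl⟩
  | _, _, _, g', nil => rfl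
  | _, _, _, g', cons g'' x => by
    have key : ∀ u, unsnoc g'' (x.snoc g) = u → unsnoc g' (cons g'' (x.snoc g)) =
        ⟨u.mid, u.q, cons g' u.init, u.first, congrArg (cons g') u.eq⟩ := by
      rintro _ rfl
      rfl
    exact key _ (unsnoc_snoc g g'' x)

variable {M : Type*} [AddCommGroup M]

/-- The value on the bar differential of `x` of the linear extension of a function `F` of
chains. -/
def barSum [Module k M] {d d' : D.Obj} (F : Chain D d d' → M) (x : Chain D d d') : M :=
  ((bar x).map fun t => sgn k t.1 • F t.2.1).sum

theorem map_barSum [Module k M] {N : Type*} [AddCommGroup N] [Module k N] (L : M →ₗ[k] N)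
    {d d' : D.Obj} (F : Chain D d d' → M)
    (x : Chain D d d') : L (barSum F x) = barSum (fun y => L (F y)) x := by
  simp only [barSum, map_list_sum, List.map_map]
  congr 2
  funext t
  exact map_smul _ _ _

theorem barSum_cons_nil [Module k M] {d d' : D.Obj} {p : ℤ} (F : Chain D d d' → M)
    (g : D.Hom d d' p) :
    barSum F (cons g nil) = -F (cons (D.d p (p + 1) rfl g) nil) := by
  simp [barSum, bar, contract, sgn_one]

theorem barSum_cons_cons [Module k M] {d d₁ d₂ d₃ : D.Obj} {p q : ℤ} (F : Chain D d d₃ → M)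
    (g : D.Hom d₂ d₃ p) (g' : D.Hom d₁ d₂ q) (x : Chain D d d₁) :
    barSum F (cons g (cons g' x)) = -F (cons (D.d p (p + 1) rfl g) (cons g' x)) +
      (sgn k p • F (cons (D.comp rfl g g') x) +
        sgn k (p - 1) • barSum (fun y => F (cons g y)) (cons g' x)) := by
  rw [barSum, barSum, bar]
  simp only [contract, List.map_cons, List.map_append, List.map_nil, List.sum_cons,
    List.sum_append, List.sum_nil, add_zero, List.map_map, sgn_one, neg_smul, one_smul]
  rw [List.smul_sum, List.map_map]
  congr 4
  funext t
  simp only [Function.comp_apply, sgn_add, mul_smul]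

/-- The bar differential of `[gₙ | ⋯ | g₁ | g]`, for `n ≥ 1`. -/
theorem barSum_snoc [Module k M] {d₀ d₁ : D.Obj} {q : ℤ} (g : D.Hom d₀ d₁ q) :
    ∀ {d₂ d₃ : D.Obj} {p : ℤ} (F : Chain D d₀ d₃ → M) (g' : D.Hom d₂ d₃ p) (x : Chain D d₁ d₂),
    barSum F ((cons g' x).snoc g) = barSum (fun y => F (y.snoc g)) (cons g' x) -
      sgn k (cons g' x).deg • F ((cons g' x).snoc (D.d q (q + 1) rfl g)) +
      sgn k ((unsnoc g' x).init.deg + (unsnoc g' x).q) •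
        F ((unsnoc g' x).init.snoc (D.comp rfl (unsnoc g' x).first g))
  | _, _, p, F, g', nil => by
    change barSum F (cons g' (cons g nil)) = _
    rw [barSum_cons_cons, barSum_cons_nil, barSum_cons_nil]
    simp only [unsnoc, deg, snoc, append, add_zero, zero_add, smul_neg]
    module
  | _, _, p, F, g', cons g'' x => by
    change barSum F (cons g' (cons g'' (x.snoc g))) = _
    rw [barSum_cons_cons, barSum_cons_cons]
    have ih := barSum_snoc g (fun y => F (cons g' y)) g'' x
    change barSum _ (cons g'' (x.snoc g)) = _ at ih
    rw [ih]
    simp only [smul_add, smul_sub, smul_smul, ← sgn_add]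
    simp only [unsnoc, deg, snoc, append, add_assoc]
    module

/-- The sum of the values of `F` over all ways to cut the chain `x` into a final part and an
initial part. -/
def splitSum {d d' : D.Obj} (F : ∀ e : D.Obj, Chain D e d' → Chain D d e → M)
    (x : Chain D d d') : M :=
  ((splits x).map fun s => F s.mid s.left s.right).sum

theorem map_splitSum [Module k M] {N : Type*} [AddCommGroup N] [Module k N] (L : M →ₗ[k] N)
    {d d' : D.Obj} (F : ∀ e : D.Obj, Chain D e d' → Chain D d e → M) (x : Chain D d d') :
    L (splitSum F x) = splitSum (fun e y z => L (F e y z)) x := by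
  simp only [splitSum, map_list_sum, List.map_map]
  rfl

theorem splitSum_nil {d : D.Obj} (F : ∀ e : D.Obj, Chain D e d → Chain D d e → M) :
    splitSum F nil = F d nil nil := by
  simp [splitSum, splits]

theorem splitSum_cons {d d₁ d₂ : D.Obj} {p : ℤ} (F : ∀ e : D.Obj, Chain D e d₂ → Chain D d e → M)
    (g : D.Hom d₁ d₂ p) (x : Chain D d d₁) :
    splitSum F (cons g x) = F d₂ nil (cons g x) + splitSum (fun e y z => F e (cons g y) z) x := by
  simp only [splitSum, splits, List.map_cons, List.sum_cons, List.map_map]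
  rfl

theorem splitSum_snoc {d₀ d₁ : D.Obj} {q : ℤ} (g : D.Hom d₀ d₁ q) : ∀ {d₂ : D.Obj}
    (F : ∀ e : D.Obj, Chain D e d₂ → Chain D d₀ e → M) (x : Chain D d₁ d₂),
    splitSum F (x.snoc g) = splitSum (fun e y z => F e y (z.snoc g)) x + F d₀ (x.snoc g) nil
  | _, F, nil => by
    change splitSum F (cons g nil) = _
    rw [splitSum_cons, splitSum_nil, splitSum_nil]
    rfl
  | _, F, cons g' x => by
    change splitSum F (cons g' (x.snoc g)) = _
    rw [splitSum_cons, splitSum_cons, splitSum_snoc g _ x, add_assoc]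
    rfl

theorem splitSum_add {d d' : D.Obj} (F G : ∀ e : D.Obj, Chain D e d' → Chain D d e → M)
    (x : Chain D d d') :
    splitSum (fun e y z => F e y z + G e y z) x = splitSum F x + splitSum G x :=
  List.sum_map_add

/-- A function of pairs of chains that vanishes unless the initial part is empty only sees the
trivial cut. -/
theorem splitSum_eq_of_cons {d : D.Obj} : ∀ {d' : D.Obj}
    (F : ∀ e : D.Obj, Chain D e d' → Chain D d e → M) (x : Chain D d d'),
    (∀ (e₁ e₂ : D.Obj) (p : ℤ) (y : Chain D e₂ d') (g : D.Hom e₁ e₂ p) (z : Chain D d e₁),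
      F e₂ y (cons g z) = 0) → splitSum F x = F d x nil
  | _, F, nil, _ => splitSum_nil F
  | _, F, cons g x, h => by
    rw [splitSum_cons, h, zero_add, splitSum_eq_of_cons _ x]
    exact fun e₁ e₂ p y g' z => h e₁ e₂ p (cons g y) g' z

end Chain

open Chain

/-! ### Morphisms of the tensor product and of the twisted tensor product

The laws of the dg categories `C ⊗ D` and `C ⊗̃ D` are restated for their concrete Hom spaces, whose
module structures are then found by unification. -/

theorem tensorComp_assoc {W X Y Z : C.Obj × D.Obj} {p q r pq qr n : ℤ} (h₁ : r + q = qr)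
    (h₂ : qr + p = n) (h₃ : q + p = pq) (h₄ : r + pq = n) (c : TensorHom C D Y Z r)
    (b : TensorHom C D X Y q) (a : TensorHom C D W X p) :
    tensorComp h₂ (tensorComp h₁ c b) a = tensorComp h₄ c (tensorComp h₃ b a) :=
  (tensor C D).assoc h₁ h₂ h₃ h₄ c b a

theorem tensorComp_id {X Y : C.Obj × D.Obj} {n : ℤ} (h : n + 0 = n) (a : TensorHom C D X Y n) :
    tensorComp h a (tmul (add_zero 0) (C.id X.1) (D.id X.2)) = a :=
  (tensor C D).comp_id h a

theorem tensorD_comp {X Y Z : C.Obj × D.Obj} {p q n m p' q' : ℤ} (h : q + p = n)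
    (hn : n + 1 = m) (hp : p + 1 = p') (hq : q + 1 = q') (h₁ : q' + p = m) (h₂ : q + p' = m)
    (b : TensorHom C D Y Z q) (a : TensorHom C D X Y p) :
    tensorD n m hn (tensorComp h b a) =
      tensorComp h₁ (tensorD q q' hq b) a + sgn k q • tensorComp h₂ b (tensorD p p' hp a) :=
  (tensor C D).leibniz h hn hp hq h₁ h₂ b a

theorem tensorD_tensorD {X Y : C.Obj × D.Obj} {n m l : ℤ} (h : n + 1 = m) (h' : m + 1 = l)
    (a : TensorHom C D X Y n) : tensorD m l h' (tensorD n m h a) = 0 :=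
  (tensor C D).d_d h h' a

namespace TwistedHom

/-- The composition of `C ⊗̃ D`. -/
def comp {X Y Z : C.Obj × D.Obj} {p q n : ℤ} (h : q + p = n) :
    TwistedHom C D Y Z q →ₗ[k] TwistedHom C D X Y p →ₗ[k] TwistedHom C D X Z n :=
  (twisted C D).comp h

/-- The differential of `C ⊗̃ D`. -/
def d {X Y : C.Obj × D.Obj} (n m : ℤ) (h : n + 1 = m) :
    TwistedHom C D X Y n →ₗ[k] TwistedHom C D X Y m :=
  (twisted C D).d n m h

theorem d_d {X Y : C.Obj × D.Obj} {n m l : ℤ} (h : n + 1 = m) (h' : m + 1 = l)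
    (a : TwistedHom C D X Y n) : d m l h' (d n m h a) = 0 :=
  (twisted C D).d_d h h' a

theorem id_comp {X Y : C.Obj × D.Obj} {n : ℤ} (h : 0 + n = n) (a : TwistedHom C D X Y n) :
    comp h (mk (.id Y)) a = a :=
  (twisted C D).id_comp h a

theorem comp_id {X Y : C.Obj × D.Obj} {n : ℤ} (h : n + 0 = n) (a : TwistedHom C D X Y n) :
    comp h a (mk (.id X)) = a :=
  (twisted C D).comp_id h a

theorem comp_assoc {W X Y Z : C.Obj × D.Obj} {p q r pq qr n : ℤ} (h₁ : r + q = qr)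
    (h₂ : qr + p = n) (h₃ : q + p = pq) (h₄ : r + pq = n) (c : TwistedHom C D Y Z r)
    (b : TwistedHom C D X Y q) (a : TwistedHom C D W X p) :
    comp h₂ (comp h₁ c b) a = comp h₄ c (comp h₃ b a) :=
  (twisted C D).assoc h₁ h₂ h₃ h₄ c b a

theorem d_comp {X Y Z : C.Obj × D.Obj} {p q n m p' q' : ℤ} (h : q + p = n)
    (hn : n + 1 = m) (hp : p + 1 = p') (hq : q + 1 = q') (h₁ : q' + p = m) (h₂ : q + p' = m)
    (b : TwistedHom C D Y Z q) (a : TwistedHom C D X Y p) :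
    d n m hn (comp h b a) = comp h₁ (d q q' hq b) a + sgn k q • comp h₂ b (d p p' hp a) :=
  (twisted C D).leibniz h hn hp hq h₁ h₂ b a

theorem mk_comp {X Y Z : C.Obj × D.Obj} {p q n : ℤ} (h : q + p = n) (b : Term C D Y Z q)
    (a : Term C D X Y p) : mk (.comp h b a) = comp h (mk b) (mk a) := rfl

theorem mk_d {X Y : C.Obj × D.Obj} {n m : ℤ} (h : n + 1 = m) (a : Term C D X Y n) :
    mk (a.d m h) = d n m h (mk a) := rfl

/-- The morphism `id_c ⊗ g` of `C ⊗̃ D`. -/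
def idTen (c : C.Obj) {d d' : D.Obj} {q : ℤ} :
    D.Hom d d' q →ₗ[k] TwistedHom C D (c, d) (c, d') q where
  toFun g := mk (.right c g)
  map_add' g g' := sound (.right_add c g g')
  map_smul' r g := sound (.right_smul c r g)

theorem mk_right (c : C.Obj) {d d' : D.Obj} {q : ℤ} (g : D.Hom d d' q) :
    mk (.right c g) = idTen c g := rfl

theorem d_idTen (c : C.Obj) {d d' : D.Obj} {n m : ℤ} (h : n + 1 = m) (g : D.Hom d d' n) :
    TwistedHom.d n m h (idTen c g) = idTen c (D.d n m h g) := rfl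

theorem idTen_comp (c : C.Obj) {d₀ d₁ d₂ : D.Obj} {p q n : ℤ} (h : q + p = n)
    (g₂ : D.Hom d₁ d₂ q) (g₁ : D.Hom d₀ d₁ p) :
    idTen c (D.comp h g₂ g₁) =
      TwistedHom.comp h
        (idTen c g₂) (idTen c g₁) :=
  sound (.right_comp c h g₂ g₁)

theorem idTen_id (c : C.Obj) (d : D.Obj) :
    idTen c (D.id d) = mk (.id (c, d)) :=
  sound (.right_id c d)

/-- The morphism `ε(f; x)` of `C ⊗̃ D`, linear in `f`, as an element of the component of degree `n`
of the Hom complex; the junk value is `0` if `n` is not the degree of `ε(f; x)`. This allows sums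
over chains `x` whose degrees are not syntactically equal. -/
def epsMor {c c' : C.Obj} {d d' : D.Obj} {p : ℤ} (x : Chain D d d') (n : ℤ) :
    C.Hom c c' p →ₗ[k] TwistedHom C D (c, d) (c', d') n where
  toFun f := if h : p + x.deg = n then mk (.eps f x h) else 0
  map_add' f f' := by
    split_ifs with h
    · exact sound (.eps_add f f' x h)
    · exact (add_zero _).symm
  map_smul' r f := by
    split_ifs with h
    · exact sound (.eps_smul r f x h)
    · exact (smul_zero _).symm

theorem mk_eps {c c' : C.Obj} {d d' : D.Obj} {p n : ℤ} (f : C.Hom c c' p) (x : Chain D d d')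
    (h : p + x.deg = n) : mk (.eps f x h) = epsMor x n f := by
  simp [epsMor, h]

theorem epsMor_append_cons_add {c c' : C.Obj} {d₀ d₁ d₂ d₃ : D.Obj} {p q : ℤ} (n : ℤ)
    (f : C.Hom c c' p) (y : Chain D d₂ d₃) (g g' : D.Hom d₁ d₂ q) (x : Chain D d₀ d₁) :
    epsMor (append y (cons (g + g') x)) n f =
      epsMor (append y (cons g x)) n f + epsMor (append y (cons g' x)) n f := by
  have hd : ∀ g : D.Hom d₁ d₂ q, (append y (cons g x)).deg = y.deg + (q - 1 + x.deg) :=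
    fun g => deg_append _ _
  by_cases h : p + (y.deg + (q - 1 + x.deg)) = n
  · have hd' := fun g => (congrArg (p + ·) (hd g)).trans h
    rw [← mk_eps f _ (hd' _), ← mk_eps f _ (hd' _), ← mk_eps f _ (hd' _)]
    exact sound (.eps_chain_add f y g g' x _ _ _)
  · simp [epsMor, hd, h]

theorem epsMor_append_cons_smul {c c' : C.Obj} {d₀ d₁ d₂ d₃ : D.Obj} {p q : ℤ} (n : ℤ)
    (f : C.Hom c c' p) (r : k) (y : Chain D d₂ d₃) (g : D.Hom d₁ d₂ q) (x : Chain D d₀ d₁) :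
    epsMor (append y (cons (r • g) x)) n f = r • epsMor (append y (cons g x)) n f := by
  have hd : ∀ g : D.Hom d₁ d₂ q, (append y (cons g x)).deg = y.deg + (q - 1 + x.deg) :=
    fun g => deg_append _ _
  by_cases h : p + (y.deg + (q - 1 + x.deg)) = n
  · have hd' := fun g => (congrArg (p + ·) (hd g)).trans h
    rw [← mk_eps f _ (hd' _), ← mk_eps f _ (hd' _)]
    exact sound (.eps_chain_smul f r y g x _ _)
  · simp [epsMor, hd, h]

theorem epsMor_append_cons_id {c c' : C.Obj} {d₀ d₁ d₂ : D.Obj} {p : ℤ} (n : ℤ)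
    (f : C.Hom c c' p) (y : Chain D d₁ d₂) (x : Chain D d₀ d₁) :
    epsMor (append y (cons (D.id d₁) x)) n f = 0 := by
  by_cases h : p + (append y (cons (D.id d₁) x)).deg = n
  · rw [← mk_eps f _ h]
    exact sound (.eps_chain_id f y x _)
  · exact dif_neg h

/-- `ε(f; gₙ, …, g₁, g)` is linear in `g`. -/
def epsSnoc {c c' : C.Obj} {d₀ d₁ d₂ : D.Obj} {p q : ℤ} (x : Chain D d₁ d₂) (n : ℤ) :
    C.Hom c c' p →ₗ[k] D.Hom d₀ d₁ q →ₗ[k] TwistedHom C D (c, d₀) (c', d₂) n :=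
  LinearMap.mk₂ k (fun f g => epsMor (x.snoc g) n f) (fun _ _ _ => map_add _ _ _)
    (fun _ _ _ => map_smul _ _ _) (fun f g g' => epsMor_append_cons_add n f x g g' nil)
    (fun r f g => epsMor_append_cons_smul n f r x g nil)

theorem epsMor_id_nil (c : C.Obj) (d : D.Obj) :
    epsMor nil 0 (C.id c) = mk (.id (c, d)) := by
  rw [← mk_eps _ _ (add_zero 0)]
  exact sound (.eps_id_nil c d _)

theorem epsMor_id_cons (c : C.Obj) {d₀ d₁ d₂ : D.Obj} {q n : ℤ} (g : D.Hom d₁ d₂ q)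
    (x : Chain D d₀ d₁) : epsMor (cons g x) n (C.id c) = 0 := by
  by_cases h : 0 + (cons g x).deg = n
  · rw [← mk_eps _ _ h]
    exact sound (.eps_id c g x h)
  · exact dif_neg h

theorem epsMor_id_snoc (c : C.Obj) {d₀ d₁ d₂ : D.Obj} {q n : ℤ} (x : Chain D d₁ d₂)
    (g : D.Hom d₀ d₁ q) : epsMor (x.snoc g) n (C.id c) = 0 := by
  cases x <;> exact epsMor_id_cons c _ _

/-! ### Differential and composites of the morphisms `ε(f; x)` -/

section Additive

variable {X Y : C.Obj × D.Obj} {n : ℤ} {M : Type*} [AddCommGroup M] [Module k M]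

/-- A function of expressions that respects the formal linear structure. -/
structure IsAdditive (Φ : Term C D X Y n → M) : Prop where
  zero : Φ .zero = 0
  add (a b) : Φ (.add a b) = Φ a + Φ b
  smul (r : k) (a) : Φ (.smul r a) = r • Φ a

theorem IsAdditive.sum {Φ : Term C D X Y n → M} (hΦ : IsAdditive Φ)
    (l : List (Term C D X Y n)) : Φ (Term.sum l) = (l.map Φ).sum := by
  induction l with
  | nil => exact hΦ.zero
  | cons a l ih => rw [List.map_cons, List.sum_cons, ← ih]; exact hΦ.add _ _

theorem isAdditive_mk : IsAdditive (mk : Term C D X Y n → _) :=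
  ⟨rfl, fun _ _ => rfl, fun _ _ => rfl⟩

end Additive

/-- The value of an additive function on `d ε(f; x)` for a nonempty chain `x`. Used both for the
differential of `C ⊗̃ D` and for the homotopy. -/
theorem IsAdditive.epsD_cons {c c' : C.Obj} {d₀ d₁ d₂ : D.Obj} {M : Type*} [AddCommGroup M]
    [Module k M] {p q m : ℤ} {Φ : Term C D (c, d₀) (c', d₂) m → M} (hΦ : IsAdditive Φ)
    (f : C.Hom c c' p) (g : D.Hom d₁ d₂ q) (x : Chain D d₀ d₁) (h : p + (cons g x).deg + 1 = m)
    (F : Chain D d₀ d₂ → M) (hF : ∀ y (hy : p + y.deg = m), Φ (.eps f y hy) = F y)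
    (h' : p + 1 + (cons g x).deg = m) (h₁ : q + (p + x.deg) = m)
    (h₂ : (p + (unsnoc g x).init.deg) + (unsnoc g x).q = m) :
    Φ (Term.epsD f (cons g x) m h) =
      Φ (.eps (C.d p (p + 1) rfl f) (cons g x) h') + sgn k p • barSum F (cons g x) -
        sgn k (p * (q - 1)) • Φ (.comp h₁ (.right c' g) (.eps f x rfl)) +
        sgn k (p + (unsnoc g x).init.deg) •
          Φ (.comp h₂ (.eps f (unsnoc g x).init rfl) (.right c (unsnoc g x).first)) := by
  rw [Term.epsD, hΦ.sum]
  simp only [List.map_cons, List.map_nil, List.sum_cons, List.sum_nil, add_zero]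
  rw [hΦ.smul, hΦ.smul, hΦ.smul, hΦ.sum, List.map_map, neg_smul, barSum]
  have : (Φ ∘ fun t : ℤ × {y : Chain D d₀ d₂ // y.deg = (cons g x).deg + 1} =>
      Term.smul (sgn k t.1) (Term.eps f t.2.1 (by rw [t.2.2]; omega))) =
      fun t => sgn k t.1 • F t.2.1 := by
    funext t
    simp only [Function.comp_apply, hΦ.smul, hF]
  rw [this]
  abel

theorem d_epsMor_nil {c c' : C.Obj} {d : D.Obj} {p n m p' : ℤ} (hn : n + 1 = m) (h : p + 0 = n)
    (hp : p + 1 = p') (f : C.Hom c c' p) :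
    TwistedHom.d n m hn (epsMor (nil : Chain D d d) n f) = epsMor nil m (C.d p p' hp f) := by
  subst hp
  rw [← mk_eps f nil (by rw [deg]; exact h), ← mk_eps _ nil (by rw [deg]; omega), ← mk_d]
  rfl

/-- The differential of `ε(f; x)` for a nonempty chain `x`, whose first morphism is `g₁` and last
morphism is `g`. -/
theorem d_epsMor_cons {c c' : C.Obj} {d₀ d₁ d₂ : D.Obj} {p q n m i j : ℤ} (hn : n + 1 = m)
    (f : C.Hom c c' p) (g : D.Hom d₁ d₂ q) (x : Chain D d₀ d₁) (h : p + (cons g x).deg = n)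
    {e : D.Obj} {q' : ℤ} {y : Chain D e d₂} {g₁ : D.Hom d₀ e q'}
    {hy : append y (cons g₁ nil) = cons g x} (hu : unsnoc g x = ⟨e, q', y, g₁, hy⟩)
    (h₁ : q + i = m) (h₂ : j + q' = m) :
    TwistedHom.d n m hn (epsMor (cons g x) n f) =
      epsMor (cons g x) m (C.d p (p + 1) rfl f) +
        sgn k p • barSum (fun y => epsMor y m f) (cons g x) -
        sgn k (p * (q - 1)) •
          TwistedHom.comp h₁ (idTen c' g)
            (epsMor x i f) +
        sgn k (p + y.deg) •
          TwistedHom.comp h₂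
            (epsMor y j f) (idTen c g₁) := by
  have key : ∀ (u : Unsnoc (cons g x)) (_ : unsnoc g x = u) (h₂ : j + u.q = m),
      TwistedHom.d n m hn (epsMor (cons g x) n f) =
      epsMor (cons g x) m (C.d p (p + 1) rfl f) +
        sgn k p • barSum (fun y => epsMor y m f) (cons g x) -
        sgn k (p * (q - 1)) • TwistedHom.comp h₁ (idTen c' g) (epsMor x i f) +
        sgn k (p + u.init.deg) •
          TwistedHom.comp h₂ (epsMor u.init j f) (idTen c u.first) := by
    rintro _ rfl h₂
    have hu := (unsnoc g x).deg_eq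
    obtain rfl : i = p + x.deg := by rw [deg] at h; omega
    obtain rfl : j = p + (unsnoc g x).init.deg := by omega
    rw [← mk_eps f _ h, ← mk_d]
    refine (isAdditive_mk.epsD_cons f g x (by omega) (fun y => epsMor y m f)
      (fun y hy => mk_eps f y hy) (by omega) h₁ h₂).trans ?_
    rw [mk_eps, mk_comp, mk_comp, mk_right, mk_right, mk_eps, mk_eps]
  exact key _ hu h₂

/-- The expansion of `ε(f₂ ∘ f₁; x)` over the cuts of the chain `x`. -/
theorem epsMor_comp {c₀ c₁ c₂ : C.Obj} {d d' : D.Obj} {p₁ p₂ p n : ℤ} (hp : p₂ + p₁ = p)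
    (f₂ : C.Hom c₁ c₂ p₂) (f₁ : C.Hom c₀ c₁ p₁) (x : Chain D d d') (h : p + x.deg = n) :
    epsMor x n (C.comp hp f₂ f₁) = splitSum (fun e y z => sgn k (p₁ * y.deg) •
      TwistedHom.comp
        (by omega : (p₂ + y.deg) + (n - (p₂ + y.deg)) = n)
        (epsMor y (p₂ + y.deg) f₂) (epsMor z (n - (p₂ + y.deg)) f₁)) x := by
  rw [← mk_eps _ _ h, sound (.eps_comp hp f₂ f₁ x h), isAdditive_mk.sum,
    List.map_map, splitSum]
  congr 2
  funext s
  have hs := s.deg_eq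
  have hr : p₁ + s.right.deg = n - (p₂ + s.left.deg) := by omega
  simp only [Function.comp_apply, mk_smul, mk_comp, mk_eps]
  congr 1
  generalize_proofs h1 h2
  revert h1 h2
  rw [hr]
  intros
  rfl

theorem epsMor_comp_nil {c₀ c₁ c₂ : C.Obj} (d : D.Obj) {p₁ p₂ p : ℤ} (hp : p₂ + p₁ = p)
    (f₂ : C.Hom c₁ c₂ p₂) (f₁ : C.Hom c₀ c₁ p₁) :
    epsMor (nil : Chain D d d) p (C.comp hp f₂ f₁) = comp hp (epsMor nil p₂ f₂)
      (epsMor nil p₁ f₁) := by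
  have key : ∀ i j (_ : i = p₂) (_ : j = p₁) (h : i + j = p), comp h (epsMor nil i f₂)
      (epsMor nil j f₁) = comp (X := (c₀, d)) (Y := (c₁, d)) (Z := (c₂, d)) hp
        (epsMor nil p₂ f₂) (epsMor nil p₁ f₁) := by
    rintro _ _ rfl rfl _
    rfl
  rw [epsMor_comp hp f₂ f₁ nil (by rw [deg, add_zero]), splitSum_nil]
  have h₀ : (nil : Chain D d d).deg = 0 := rfl
  rw [show sgn k (p₁ * (nil : Chain D d d).deg) = 1 by rw [h₀, mul_zero, sgn_zero], one_smul]
  exact key _ _ (by omega) (by omega) _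

/-! ### The section of the projection -/

/-- The section `f ⊗ g ↦ (-1)^{|f| |g|} (id ⊗ g) (f ⊗ id)` of the projection
`C ⊗̃ D → C ⊗ D` on Hom complexes. -/
def ofTensor {X Y : C.Obj × D.Obj} {n : ℤ} : TensorHom C D X Y n →ₗ[k] TwistedHom C D X Y n :=
  tensorLift fun p q h => sgn k (p * q) •
    ((comp (X := X) (Y := (Y.1, X.2)) (Z := Y) (by omega : q + p = n)).compl₁₂ (idTen Y.1)
      (epsMor nil p)).flip

theorem ofTensor_tmul {c c' : C.Obj} {d d' : D.Obj} {p q n : ℤ} (h : p + q = n) (h' : q + p = n)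
    (f : C.Hom c c' p) (g : D.Hom d d' q) :
    ofTensor (tmul (X := (c, d)) (Y := (c', d')) h f g) =
      sgn k (p * q) • comp h' (idTen c' g) (epsMor nil p f) :=
  tensorLift_tmul (X := (c, d)) (Y := (c', d')) _ h f g

theorem projectionMap_idTen_comp_epsMor {c c' : C.Obj} {d d' : D.Obj} {p q n : ℤ}
    (h : p + q = n) (h' : q + p = n) (f : C.Hom c c' p) (g : D.Hom d d' q) :
    projectionMap (comp h' (idTen c' g) (epsMor nil p f)) =
      sgn k (p * q) • tmul (X := (c, d)) (Y := (c', d')) h f g := by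
  rw [← mk_eps f nil (by rw [deg, add_zero]), ← mk_right, ← mk_comp]
  refine (tensorComp_tmul (X := (c, d)) (Y := (c', d)) (Z := (c', d')) h' (zero_add q)
    (add_zero p) (zero_add p) (add_zero q) h (C.id c') g f (D.id d)).trans ?_
  rw [C.id_comp, D.comp_id, mul_comm]

theorem projectionMap_ofTensor {X Y : C.Obj × D.Obj} {n : ℤ} (t : TensorHom C D X Y n) :
    projectionMap (ofTensor t) = t := by
  induction t using tensorHom_induction with
  | zero => rw [map_zero, map_zero]
  | add a b ha hb => rw [map_add, map_add, ha, hb]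
  | tmul p q h f g =>
    obtain ⟨c, d⟩ := X
    obtain ⟨c', d'⟩ := Y
    rw [ofTensor_tmul h (by omega), map_smul, projectionMap_idTen_comp_epsMor h, smul_smul,
      sgn_mul_self, one_smul]

theorem ofTensor_id (X : C.Obj × D.Obj) :
    ofTensor (tmul (add_zero 0) (C.id X.1) (D.id X.2)) = mk (.id X) := by
  obtain ⟨c, d⟩ := X
  rw [ofTensor_tmul (add_zero 0) (add_zero 0), idTen_id, epsMor_id_nil, id_comp, zero_mul,
    sgn_zero, one_smul]

theorem d_ofTensor {X Y : C.Obj × D.Obj} {n m : ℤ} (h : n + 1 = m) (t : TensorHom C D X Y n) :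
    d n m h (ofTensor t) = ofTensor (tensorD n m h t) := by
  induction t using tensorHom_induction with
  | zero => simp only [map_zero]
  | add a b ha hb => simp only [map_add, ha, hb]
  | tmul p q hpq f g =>
    obtain ⟨c, d⟩ := X
    obtain ⟨c', d'⟩ := Y
    rw [tensorD_tmul h hpq rfl rfl (by omega) (by omega), map_add, map_smul,
      ofTensor_tmul hpq (by omega), ofTensor_tmul _ (by omega), ofTensor_tmul _ (by omega),
      map_smul, d_comp _ h rfl rfl (by omega) (by omega), d_idTen,
      d_epsMor_nil rfl (add_zero p) rfl]
    simp only [smul_add, smul_smul, mul_add, add_mul, one_mul, mul_one, sgn_add]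
    have := sgn_mul_self k p
    match_scalars <;> grind

/-- `(id ⊗ g₀) s(t) = s((id ⊗ g₀) t)` for the section `s`. -/
theorem idTen_comp_ofTensor {W : C.Obj × D.Obj} {c : C.Obj} {d d' : D.Obj} {q r n : ℤ}
    (h : q + r = n) (g₀ : D.Hom d d' q) (t : TensorHom C D W (c, d) r) :
    comp h (idTen c g₀) (ofTensor t) =
      ofTensor (tensorComp h (tmul (X := (c, d)) (Y := (c, d')) (zero_add q) (C.id c) g₀) t) := by
  induction t using tensorHom_induction with
  | zero => simp only [map_zero]
  | add a b ha hb => simp only [map_add, ha, hb]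
  | tmul a b hab f g =>
    obtain ⟨c₀, d₀⟩ := W
    rw [tensorComp_tmul h (zero_add q) hab (zero_add a) rfl (by omega), map_smul,
      ofTensor_tmul hab (by omega), ofTensor_tmul _ (by omega), map_smul, C.id_comp,
      idTen_comp, comp_assoc rfl _ (by omega : b + a = r) h, smul_smul, ← sgn_add]
    congr 1
    exact sgn_congr k (-(q * a)) (by ring)

/-! ### The contracting homotopy -/

/-- The contracting homotopy `H(a; t)`, for an expression `a : X → Y` in the generators of `C ⊗̃ D`
and a morphism `t : W → X` of `C ⊗ D`; it lowers the total degree by one. It is defined by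
recursion on `a`, as a derivation, from `H(ε(φ; x); f ⊗ g) = ± ε(φ; [x | g]) (f ⊗ id)` and
`H(id ⊗ g'; t) = 0`; here `x` may be empty. The degree `m` of the value is a
free variable to avoid casts. -/
def homotopy : ∀ {X Y : C.Obj × D.Obj} {n : ℤ}, Term C D X Y n →
    ∀ {W : C.Obj × D.Obj} {r m : ℤ}, n + r = m + 1 →
      (TensorHom C D W X r →ₗ[k] TwistedHom C D W Y m)
  | _, _, _, .zero, _, _, _, _ => 0
  | _, _, _, .add a b, _, _, _, h => homotopy a h + homotopy b h
  | _, _, _, .smul s a, _, _, _, h => s • homotopy a h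
  | _, _, _, .id _, _, _, _, _ => 0
  | _, _, _, .comp (p := p) (q := q) _ b a, _, r, m, _ =>
    homotopy b (r := p + r) (by omega) ∘ₗ tensorComp rfl a.eval +
      sgn k q • comp (by omega : q + (m - q) = m) (mk b) ∘ₗ homotopy a (by omega)
  | _, _, _, .right _ _, _, _, _, _ => 0
  | _, _, n, .eps (c := c) (c' := c') (d := _) (d' := d') φ x _, W, _, m, _ =>
    tensorLift fun p q _ => sgn k (n + p * q) •
      ((comp (X := W) (Y := (c, W.2)) (Z := (c', d')) (by omega : (m - p) + p = m)).compl₁₂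
        (epsSnoc x (m - p) φ) (epsMor nil p)).flip

theorem isAdditive_homotopy {X Y W : C.Obj × D.Obj} {n r m : ℤ} (h : n + r = m + 1)
    (t : TensorHom C D W X r) : IsAdditive fun a : Term C D X Y n => homotopy a h t :=
  ⟨rfl, fun _ _ => rfl, fun _ _ => rfl⟩

theorem homotopy_comp {X Y Z W : C.Obj × D.Obj} {p q n r m i j : ℤ} (h : q + p = n)
    (b : Term C D Y Z q) (a : Term C D X Y p) (h' : n + r = m + 1) (hi : p + r = i)
    (hb : q + i = m + 1) (ha : p + r = j + 1) (hj : q + j = m) (t : TensorHom C D W X r) :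
    homotopy (.comp h b a) h' t =
      homotopy b hb (tensorComp hi a.eval t) + sgn k q • comp hj (mk b) (homotopy a ha t) := by
  subst hi
  obtain rfl : j = m - q := by omega
  rfl

theorem homotopy_right {W : C.Obj × D.Obj} {c : C.Obj} {d d' : D.Obj} {n r m : ℤ}
    (g : D.Hom d d' n) (h : n + r = m + 1) (t : TensorHom C D W (c, d) r) :
    homotopy (.right c g) h t = 0 := rfl

theorem homotopy_eps_tmul {c₀ c c' : C.Obj} {d₀ d d' : D.Obj} {p a b n r m i : ℤ}
    (φ : C.Hom c c' p) (x : Chain D d d') (hx : p + x.deg = n) (h : n + r = m + 1)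
    (hab : a + b = r) (hi : i + a = m) (f : C.Hom c₀ c a) (g : D.Hom d₀ d b) :
    homotopy (.eps φ x hx) h (tmul (X := (c₀, d₀)) (Y := (c, d)) hab f g) =
      sgn k (n + a * b) • comp hi (epsMor (x.snoc g) i φ) (epsMor nil a f) := by
  obtain rfl : i = m - a := by omega
  exact tensorLift_tmul (X := (c₀, d₀)) (Y := (c, d)) _ hab f g

/-! ### The homotopy identity -/

/-- The homotopy identity for `φ ⊗ id`. -/
theorem d_homotopy_eps_nil {c₀ c c' : C.Obj} {d₀ e : D.Obj} {p a b n m l n' r r' : ℤ}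
    (φ : C.Hom c c' p) (hx : p + (nil : Chain D e e).deg = n) (hab : a + b = r) (h : n + r = l)
    (hm : m + 1 = l) (hn : n + 1 = n') (hr : r + 1 = r') (h₀ : n + r = m + 1)
    (h₁ : n' + r = l + 1) (h₂ : n + r' = l + 1) (f : C.Hom c₀ c a) (g : D.Hom d₀ e b) :
    d m l hm (homotopy (.eps φ (nil : Chain D e e) hx) h₀
        (tmul (X := (c₀, d₀)) (Y := (c, e)) hab f g)) +
      homotopy ((Term.eps φ (nil : Chain D e e) hx).d n' hn) h₁
        (tmul (X := (c₀, d₀)) (Y := (c, e)) hab f g) +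
      sgn k n • homotopy (.eps φ (nil : Chain D e e) hx) h₂
        (tensorD r r' hr (tmul (X := (c₀, d₀)) (Y := (c, e)) hab f g)) =
      comp h (mk (.eps φ (nil : Chain D e e) hx))
        (ofTensor (tmul (X := (c₀, d₀)) (Y := (c, e)) hab f g)) -
      ofTensor (tensorComp h (Term.eval (.eps φ (nil : Chain D e e) hx))
        (tmul (X := (c₀, d₀)) (Y := (c, e)) hab f g)) := by
  obtain rfl : n = p := by rw [deg] at hx; omega
  subst hn
  have hd : (Term.eps φ (nil : Chain D e e) hx).d (n + 1) rfl =
      .eps (C.d n (n + 1) rfl φ) nil (by rw [deg]; omega) := rfl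
  have he : Term.eval (.eps φ (nil : Chain D e e) hx) =
      tmul (X := (c, e)) (Y := (c', e)) (add_zero n) φ (D.id e) := rfl
  rw [hd, he, tensorD_tmul hr hab rfl rfl (by omega) (by omega), map_add, map_smul,
    homotopy_eps_tmul (i := n + b - 1) _ _ _ _ _ (by omega),
    homotopy_eps_tmul (i := n + b) _ _ _ _ _ (by omega),
    homotopy_eps_tmul (i := n + b - 1) _ _ _ _ _ (by omega),
    homotopy_eps_tmul (i := n + b) _ _ _ _ _ (by omega),
    tensorComp_tmul h _ _ rfl (zero_add b) (by omega), D.id_comp]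
  simp only [map_smul]
  rw [ofTensor_tmul hab (by omega), ofTensor_tmul _ (by omega), epsMor_comp_nil, mk_eps,
    map_smul, d_comp (q' := n + b) _ hm rfl (by omega) (by omega) (by omega),
    d_epsMor_nil rfl (add_zero a) rfl]
  have hs : ∀ {q : ℤ} (g : D.Hom d₀ e q), (nil : Chain D e e).snoc g = cons g nil := fun _ => rfl
  simp only [hs]
  rw [d_epsMor_cons (i := n) (j := n) (by omega) φ g nil (by simp only [deg]; omega)
    ((rfl : unsnoc g nil = ⟨e, b, nil, g, rfl⟩)) (by omega) rfl, barSum_cons_nil]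
  simp only [map_add, map_sub, map_neg, map_smul, LinearMap.add_apply,
    LinearMap.sub_apply, LinearMap.neg_apply, LinearMap.smul_apply]
  rw [comp_assoc _ _ rfl (by omega), comp_assoc _ _ (by omega : b + a = r) h]
  simp only [mul_add, add_mul, mul_sub, mul_one, one_mul, sgn_add, sgn_sub, deg,
    sgn_zero, zero_mul, sgn_one]
  -- all coefficients are products of these signs
  have := sgn_mul_self k n
  have := sgn_mul_self k a
  have := sgn_mul_self k b
  have := sgn_mul_self k (n * b)
  have := sgn_mul_self k (a * b)
  match_scalars <;> grind

/-- The homotopy identity for `ε(φ; g₁, …, gₙ)` with `n ≥ 1`. -/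
theorem d_homotopy_eps_cons {c₀ c c' : C.Obj} {d₀ e d₁ d₂ : D.Obj}
    {p q a b n m l n' r r' : ℤ} (φ : C.Hom c c' p) (g' : D.Hom d₁ d₂ q) (x : Chain D e d₁)
    (hx : p + (cons g' x).deg = n) (hab : a + b = r) (h : n + r = l)
    (hm : m + 1 = l) (hn : n + 1 = n') (hr : r + 1 = r') (h₀ : n + r = m + 1)
    (h₁ : n' + r = l + 1) (h₂ : n + r' = l + 1) (f : C.Hom c₀ c a) (g : D.Hom d₀ e b) :
    d m l hm (homotopy (.eps φ (cons g' x) hx) h₀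
        (tmul (X := (c₀, d₀)) (Y := (c, e)) hab f g)) +
      homotopy ((Term.eps φ (cons g' x) hx).d n' hn) h₁
        (tmul (X := (c₀, d₀)) (Y := (c, e)) hab f g) +
      sgn k n • homotopy (.eps φ (cons g' x) hx) h₂
        (tensorD r r' hr (tmul (X := (c₀, d₀)) (Y := (c, e)) hab f g)) =
      comp h (mk (.eps φ (cons g' x) hx))
        (ofTensor (tmul (X := (c₀, d₀)) (Y := (c, e)) hab f g)) -
      ofTensor (tensorComp h (Term.eval (.eps φ (cons g' x) hx))
        (tmul (X := (c₀, d₀)) (Y := (c, e)) hab f g)) := by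
  subst hn
  have he : Term.eval (.eps φ (cons g' x) hx) = 0 := rfl
  have her : ∀ {c : C.Obj} {d d' : D.Obj} {q : ℤ} (g : D.Hom d d' q), Term.eval (.right c g) =
      tmul (X := (c, d)) (Y := (c, d')) (zero_add q) (C.id c) g := fun _ => rfl
  have hdeg : (cons g' x).deg = q - 1 + x.deg := rfl
  have hu := (unsnoc g' x).deg_eq
  have hd := (isAdditive_homotopy h₁ (tmul (X := (c₀, d₀)) (Y := (c, e)) hab f g)).epsD_cons
    φ g' x (by omega)
    (fun y => sgn k (n + 1 + a * b) • comp (by omega : (n + b) + a = l)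
      (epsMor (y.snoc g) (n + b) φ) (epsMor nil a f))
    (fun y hy => homotopy_eps_tmul (i := n + b) _ _ _ _ _ (by omega) _ _) (by omega) (by omega)
    (by omega)
  change homotopy ((Term.eps φ (cons g' x) hx).d (n + 1) rfl) h₁ _ = _ at hd
  have hs : (cons g' x).snoc g = cons g' (x.snoc g) := rfl
  rw [hd, he, tensorD_tmul hr hab rfl rfl (by omega) (by omega), map_add, map_smul,
    LinearMap.map_zero₂, map_zero, sub_zero,
    homotopy_eps_tmul (i := n + b - 1) _ _ _ _ _ (by omega),
    homotopy_eps_tmul (i := n + b) _ _ _ _ _ (by omega),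
    homotopy_eps_tmul (i := n + b - 1) _ _ _ _ _ (by omega),
    homotopy_eps_tmul (i := n + b) _ _ _ _ _ (by omega),
    homotopy_comp (p := p + x.deg) (q := q) (j := p + x.deg + r - 1) _ _ _ h₁ rfl (by omega)
      (by omega) (by omega),
    homotopy_comp (p := (unsnoc g' x).q) (j := (unsnoc g' x).q + r - 1) _ _ _ h₁ rfl (by omega)
      (by omega) (by omega), homotopy_right, homotopy_right,
    her, tensorComp_tmul rfl _ _ (zero_add a) rfl (by omega), C.id_comp,
    homotopy_eps_tmul (i := p + x.deg + b - 1) _ _ _ _ _ (by omega)]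
  simp only [map_smul, map_zero, smul_zero, add_zero, zero_add]
  rw [homotopy_eps_tmul (i := n + b) _ _ _ _ _ (by omega), ofTensor_tmul hab (by omega), mk_eps,
    map_smul, d_comp (q' := n + b) _ hm rfl (by omega) (by omega) (by omega),
    d_epsMor_nil rfl (add_zero a) rfl]
  rw [hs, d_epsMor_cons (i := p + x.deg + b - 1) (j := n) (by omega) φ g' (x.snoc g)
    (by simp only [deg, deg_snoc]; omega) (unsnoc_snoc g g' x) (by omega) rfl, ← hs, barSum_snoc]
  have hbar := map_barSum (sgn k (n + 1 + a * b) •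
    (comp (X := (c₀, d₀)) (by omega : (n + b) + a = l)).flip (epsMor nil a f))
    (fun y : Chain D e d₂ => epsMor (y.snoc g) (n + b) φ) (cons g' x)
  simp only [LinearMap.smul_apply, LinearMap.flip_apply] at hbar
  rw [← hbar]
  simp only [map_add, map_sub, map_smul, LinearMap.add_apply, LinearMap.sub_apply,
    LinearMap.smul_apply]
  rw [mk_right, comp_assoc _ _ (by omega) (by omega : q + (p + x.deg + r - 1) = l),
    comp_assoc _ _ (by omega : b + a = r) h]
  obtain rfl : n = p + (q - 1 + x.deg) := by omega
  have hi : (unsnoc g' x).init.deg = (q - 1 + x.deg) + 1 - (unsnoc g' x).q := by omega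
  simp only [hi, hdeg, mul_add, add_mul, mul_sub, mul_one, one_mul, sgn_add, sgn_sub,
    sgn_one]
  -- all coefficients are products of these signs
  have := sgn_mul_self k p
  have := sgn_mul_self k q
  have := sgn_mul_self k x.deg
  have := sgn_mul_self k a
  have := sgn_mul_self k b
  have := sgn_mul_self k (p * q)
  have := sgn_mul_self k (a * b)
  have := sgn_mul_self k (unsnoc g' x).q
  have := sgn_mul_self k ((unsnoc g' x).q * a)
  have := mul_comm a (unsnoc g' x).q
  match_scalars <;> grind

/-- The combination of the signs in the homotopy identity for a composite `b a` of elements of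
degrees `q` and `p`. -/
theorem leibniz_sum {M : Type*} [AddCommGroup M] [Module k M] (p q : ℤ)
    (x₁ x₂ x₃ x₄ x₅ x₆ x₇ x₈ : M) :
    x₁ + sgn k q • (x₂ + sgn k q • x₃) +
        (x₄ + sgn k (q + 1) • x₂ + sgn k q • (x₅ + sgn k q • x₆)) +
        sgn k (q + p) • (x₇ + sgn k q • x₈) =
      (x₃ + x₆ + sgn k p • x₈) + (x₁ + x₄ + sgn k q • (x₅ + sgn k p • x₇)) := by
  simp only [sgn_add, sgn_one]
  have := sgn_mul_self k q
  match_scalars <;> grind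

/-- The homotopy identity `d H(a; t) + H(da; t) + (-1)^{|a|} H(a; dt) = a s(t) - s(p(a) t)`. -/
theorem d_homotopy : ∀ {X Y : C.Obj × D.Obj} {n : ℤ} (a : Term C D X Y n) {W : C.Obj × D.Obj}
    {r m l n' r' : ℤ} (h : n + r = l) (hm : m + 1 = l) (hn : n + 1 = n') (hr : r + 1 = r')
    (h₀ : n + r = m + 1) (h₁ : n' + r = l + 1) (h₂ : n + r' = l + 1) (t : TensorHom C D W X r),
    d m l hm (homotopy a h₀ t) + homotopy (a.d n' hn) h₁ t +
      sgn k n • homotopy a h₂ (tensorD r r' hr t) =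
        comp h (mk a) (ofTensor t) - ofTensor (tensorComp h a.eval t)
  | _, _, _, .zero, _, _, _, _, _, _, h, hm, hn, hr, h₀, h₁, h₂, t => by
    change d _ _ hm 0 + 0 + sgn k _ • 0 = comp h 0 (ofTensor t) - ofTensor (tensorComp h 0 t)
    simp only [map_zero, LinearMap.zero_apply, smul_zero, add_zero, sub_zero]
  | _, _, _, .add a b, _, _, _, _, _, _, h, hm, hn, hr, h₀, h₁, h₂, t => by
    have ha := d_homotopy a h hm hn hr h₀ h₁ h₂ t
    have hb := d_homotopy b h hm hn hr h₀ h₁ h₂ t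
    change d _ _ hm (homotopy a h₀ t + homotopy b h₀ t) +
      (homotopy (a.d _ hn) h₁ t + homotopy (b.d _ hn) h₁ t) +
      sgn k _ • (homotopy a h₂ (tensorD _ _ hr t) + homotopy b h₂ (tensorD _ _ hr t)) =
        comp h (mk a + mk b) (ofTensor t) - ofTensor (tensorComp h (a.eval + b.eval) t)
    simp only [map_add, LinearMap.add_apply]
    rw [add_sub_add_comm, ← ha, ← hb]
    module
  | _, _, _, .smul s a, _, _, _, _, _, _, h, hm, hn, hr, h₀, h₁, h₂, t => by
    have ha := d_homotopy a h hm hn hr h₀ h₁ h₂ t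
    change d _ _ hm (s • homotopy a h₀ t) + s • homotopy (a.d _ hn) h₁ t +
      sgn k _ • s • homotopy a h₂ (tensorD _ _ hr t) =
        comp h (s • mk a) (ofTensor t) - ofTensor (tensorComp h (s • a.eval) t)
    simp only [map_smul, LinearMap.smul_apply]
    rw [← smul_sub, ← ha]
    module
  | X, _, _, .id _, _, _, _, _, _, _, h, hm, hn, hr, h₀, h₁, h₂, t => by
    obtain rfl := (zero_add _).symm.trans h
    change d _ _ hm 0 + 0 + sgn k _ • 0 = comp h (mk (.id X)) (ofTensor t) -
      ofTensor (tensorComp h (tmul (add_zero 0) (C.id X.1) (D.id X.2)) t)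
    rw [id_comp, show tensorComp h (tmul (add_zero 0) (C.id X.1) (D.id X.2)) t = t from
      (tensor C D).id_comp h t, sub_self, map_zero, smul_zero, add_zero, add_zero]
  | _, _, _, .comp (p := p) (q := q) h' b a, _, r, m, l, n', r', h, hm, hn, hr, h₀, h₁, h₂, t => by
    subst h' hn hr
    have hb := d_homotopy b (r := p + r) (n' := q + 1) (by omega) hm rfl rfl (by omega)
      (by omega) (by omega) (tensorComp rfl a.eval t)
    have ha := congrArg (comp (by omega : q + (p + r) = l) (mk b))
      (d_homotopy a (m := p + r - 1) (n' := p + 1) rfl (by omega) rfl rfl (by omega) (by omega)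
        (by omega) t)
    have hd : (Term.comp rfl b a).d (q + p + 1) rfl = .add
      (.comp (by omega) (b.d (q + 1) rfl) a)
      (.smul (sgn k q) (.comp (by omega) b (a.d (p + 1) rfl))) := rfl
    rw [tensorD_comp rfl rfl rfl rfl (by omega) (by omega), ← Term.eval_d, map_add, map_smul] at hb
    simp only [map_add, map_sub, map_smul] at ha
    rw [hd, (isAdditive_homotopy h₁ t).add, (isAdditive_homotopy h₁ t).smul]
    rw [homotopy_comp (j := p + r - 1) rfl b a h₀ rfl (by omega) (by omega) (by omega),
      homotopy_comp (j := p + r - 1) _ (b.d (q + 1) rfl) a h₁ rfl (by omega) (by omega) (by omega),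
      homotopy_comp (i := p + r + 1) (j := p + r) _ b (a.d (p + 1) rfl) h₁ (by omega) (by omega)
        (by omega) (by omega),
      homotopy_comp (i := p + r + 1) (j := p + r) rfl b a h₂ (by omega) (by omega) (by omega)
        (by omega), map_add, map_smul,
      d_comp (p' := p + r) (q' := q + 1) _ hm (by omega) rfl (by omega) (by omega),
      mk_comp, comp_assoc rfl h rfl (by omega), mk_d]
    have he : Term.eval (.comp rfl b a) = tensorComp (rfl : q + p = q + p) b.eval a.eval := rfl
    rw [he, tensorComp_assoc rfl h rfl (by omega)]
    refine Eq.trans ?_ ((congrArg₂ (· + ·) ha hb).trans (sub_add_sub_cancel _ _ _))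
    exact leibniz_sum p q _ _ _ _ _ _ _ _
  | _, _, _, .right c g, _, _, _, _, _, _, h, hm, hn, hr, h₀, h₁, h₂, t => by
    change d _ _ hm 0 + 0 + sgn k _ • 0 = comp h (idTen c g) (ofTensor t) - ofTensor
      (tensorComp h (tmul (X := (c, _)) (Y := (c, _)) (zero_add _) (C.id c) g) t)
    rw [idTen_comp_ofTensor, sub_self, map_zero, smul_zero, add_zero, add_zero]
  | _, _, _, .eps (c := c) (d := e) φ x hx, W, r, m, l, n', r', h, hm, hn, hr, h₀, h₁, h₂, t => by
    obtain ⟨c₀, d₀⟩ := W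
    induction t using tensorHom_induction with
    | zero => simp only [map_zero, smul_zero, add_zero, sub_zero]
    | add s t hs ht =>
      simp only [map_add, smul_add]
      rw [add_sub_add_comm, ← hs, ← ht]
      abel
    | tmul a b hab f g =>
      cases x with
      | nil => exact d_homotopy_eps_nil φ hx hab h hm hn hr h₀ h₁ h₂ f g
      | cons g' x => exact d_homotopy_eps_cons φ g' x hx hab h hm hn hr h₀ h₁ h₂ f g

/-! ### Compatibility of the homotopy with the relations -/

/-- The homotopy respects the expansion of `ε(f₂ ∘ f₁; x)`: by `splitSum_snoc`, the cuts of
`[x | g]` are those of `x` with `g` added to the initial part, and the one with empty initial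
part. -/
theorem homotopy_eps_comp {c₀ c₁ c₂ : C.Obj} {d d' : D.Obj} {p₁ p₂ p n : ℤ} (hp : p₂ + p₁ = p)
    (f₂ : C.Hom c₁ c₂ p₂) (f₁ : C.Hom c₀ c₁ p₁) (x : Chain D d d') (hx : p + x.deg = n)
    {W : C.Obj × D.Obj} {r m : ℤ} (h : n + r = m + 1) (t : TensorHom C D W (c₀, d) r) :
    homotopy (.eps (C.comp hp f₂ f₁) x hx) h t =
      homotopy (Term.sum ((splits x).map fun s => .smul (sgn k (p₁ * s.left.deg))
        (.comp (by have := s.deg_eq; omega : (p₂ + s.left.deg) + (p₁ + s.right.deg) = n)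
          (.eps f₂ s.left rfl) (.eps f₁ s.right rfl)))) h t := by
  obtain ⟨c, d₀⟩ := W
  induction t using tensorHom_induction with
  | zero => simp only [map_zero]
  | add s t hs ht => simp only [map_add, hs, ht]
  | tmul a b hab f g =>
    have hS := (isAdditive_homotopy (C := C) (D := D) (X := (c₀, d)) (Y := (c₂, d')) h
      (tmul (X := (c, d₀)) (Y := (c₀, d)) hab f g)).sum
      ((splits x).map fun s => .smul (sgn k (p₁ * s.left.deg))
        (.comp (by have := s.deg_eq; omega : (p₂ + s.left.deg) + (p₁ + s.right.deg) = n)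
          (.eps f₂ s.left rfl) (.eps f₁ s.right rfl)))
    refine Eq.trans ?_ hS.symm
    rw [List.map_map]
    -- the summands in which `g` is added to the initial part of the chain
    let F : ∀ e : D.Obj, Chain D e d' → Chain D d e → TwistedHom C D (c, d₀) (c₂, d') m :=
      fun e y z => sgn k (p₁ * y.deg) • sgn k (p₂ + y.deg) • sgn k (n - (p₂ + y.deg) + a * b) •
        comp (by omega : (p₂ + y.deg) + (m - (p₂ + y.deg)) = m) (epsMor y (p₂ + y.deg) f₂)
          (comp (by omega : (n + b - 1 - (p₂ + y.deg)) + a = m - (p₂ + y.deg))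
            (epsMor (z.snoc g) (n + b - 1 - (p₂ + y.deg)) f₁) (epsMor nil a f))
    -- the summand in which `g` is added to the final part `x` and the initial part is empty
    let G : ∀ e : D.Obj, Chain D e d' → Chain D d e → TwistedHom C D (c, d₀) (c₂, d') m :=
      fun e y z => match e, y, z with
        | _, y, .nil => sgn k (p₁ * y.deg) • sgn k (p₂ + y.deg + (p₁ + a) * b) •
            comp (by omega : (m - (p₁ + a)) + (p₁ + a) = m) (epsMor (y.snoc g) (m - (p₁ + a)) f₂)
              (epsMor nil (p₁ + a) (C.comp rfl f₁ f))
        | _, _, .cons _ _ => 0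
    have hFG : ∀ s : Split x, F s.mid s.left s.right + G s.mid s.left s.right =
        homotopy (.smul (sgn k (p₁ * s.left.deg))
          (.comp (by have := s.deg_eq; omega : (p₂ + s.left.deg) + (p₁ + s.right.deg) = n)
            (.eps f₂ s.left rfl) (.eps f₁ s.right rfl))) h
          (tmul (X := (c, d₀)) (Y := (c₀, d)) hab f g) := by
      rintro ⟨e, y, z, hs⟩
      have hs' : y.deg + z.deg = x.deg := by rw [← hs, deg_append]
      have hn' : (p₂ + y.deg) + (p₁ + z.deg) = n := by omega
      change F e y z + G e y z = homotopy (.smul (sgn k (p₁ * y.deg))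
        (.comp hn' (.eps f₂ y rfl) (.eps f₁ z rfl))) h _
      rw [(isAdditive_homotopy h _).smul,
        homotopy_comp (i := p₁ + z.deg + r) (j := m - (p₂ + y.deg)) _ _ _ h rfl (by omega)
          (by omega) (by omega), homotopy_eps_tmul (i := n + b - 1 - (p₂ + y.deg)) f₁ z rfl _ hab
          (by omega), mk_eps, map_smul, smul_add, add_comm]
      have hn : n - (p₂ + y.deg) = p₁ + z.deg := by omega
      refine congrArg₂ (· + ·) ?_ ?_
      · cases z with
        | nil =>
          have he : Term.eval (.eps f₁ (nil : Chain D d d) rfl) =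
            tmul (X := (c₀, d)) (Y := (c₁, d)) (by rw [deg]) f₁ (D.id d) := rfl
          rw [he, tensorComp_tmul _ _ _ rfl (zero_add b) (by rw [deg]; omega), D.id_comp, map_smul,
            zero_mul, sgn_zero, one_smul,
            homotopy_eps_tmul (i := m - (p₁ + a)) _ _ _ _ _ (by omega)]
        | cons g' z =>
          have he : Term.eval (.eps f₁ (cons g' z) rfl) = 0 := rfl
          rw [he, LinearMap.map_zero₂, map_zero, smul_zero]
      · change sgn k _ • sgn k _ • sgn k (n - (p₂ + y.deg) + a * b) • _ = _
        rw [hn]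
    have hsum : splitSum F x + splitSum G x = ((splits x).map fun s =>
        homotopy (.smul (sgn k (p₁ * s.left.deg))
          (.comp (by have := s.deg_eq; omega : (p₂ + s.left.deg) + (p₁ + s.right.deg) = n)
            (.eps f₂ s.left rfl) (.eps f₁ s.right rfl))) h
          (tmul (X := (c, d₀)) (Y := (c₀, d)) hab f g)).sum := by
      rw [← splitSum_add, splitSum]
      exact congrArg List.sum (List.map_congr_left fun s _ => hFG s)
    refine Eq.trans ?_ hsum
    rw [splitSum_eq_of_cons G x fun _ _ _ _ _ _ => rfl,
      homotopy_eps_tmul (i := n + b - 1) _ _ _ _ _ (by omega),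
      epsMor_comp hp f₂ f₁ (x.snoc g) (by rw [deg_snoc]; omega), splitSum_snoc, map_add,
      LinearMap.add_apply, smul_add]
    refine congrArg₂ (· + ·) ?_ ?_
    · have hL := map_splitSum (sgn k (n + a * b) •
        (comp (X := (c, d₀)) (Y := (c₀, d₀)) (Z := (c₂, d'))
          (by omega : (n + b - 1) + a = m)).flip (epsMor nil a f))
        (fun e (y : Chain D e d') (z : Chain D d e) => sgn k (p₁ * y.deg) •
          comp (by omega : (p₂ + y.deg) + (n + b - 1 - (p₂ + y.deg)) = n + b - 1)
            (epsMor y (p₂ + y.deg) f₂) (epsMor (z.snoc g) (n + b - 1 - (p₂ + y.deg)) f₁)) x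
      refine hL.trans ?_
      refine congrArg (fun H => splitSum H x) (funext fun e => funext fun y => funext fun z => ?_)
      simp only [LinearMap.smul_apply, LinearMap.flip_apply, map_smul]
      rw [comp_assoc _ _ (by omega : (n + b - 1 - (p₂ + y.deg)) + a = m - (p₂ + y.deg)) (by omega)]
      simp only [F, smul_smul, sgn_add, sgn_sub]
      have := sgn_mul_self k p₂
      have := sgn_mul_self k y.deg
      match_scalars
      grind
    · have key : ∀ i j (_ : i = m - (p₁ + a)) (_ : j = p₁) (h : i + j = n + b - 1),
          comp (X := (c₀, d₀)) h (epsMor (x.snoc g) i f₂) (epsMor nil j f₁) =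
            comp (Y := (c₁, d₀)) (by omega : m - (p₁ + a) + p₁ = n + b - 1)
              (epsMor (x.snoc g) (m - (p₁ + a)) f₂) (epsMor nil p₁ f₁) := by
        rintro _ _ rfl rfl _
        rfl
      have hd := deg_snoc x g
      change _ = sgn k (p₁ * x.deg) • sgn k (p₂ + x.deg + (p₁ + a) * b) • comp _
        (epsMor (x.snoc g) (m - (p₁ + a)) f₂) (epsMor nil (p₁ + a) (C.comp rfl f₁ f))
      rw [key _ _ (by omega) (by omega), map_smul, LinearMap.smul_apply, epsMor_comp_nil,
        comp_assoc _ _ rfl (by omega), smul_smul, smul_smul, ← sgn_add, ← sgn_add, hd]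
      congr 1
      obtain rfl : n = p₂ + p₁ + x.deg := by omega
      exact sgn_congr k 0 (by ring)

/-- The conclusion `H(d(da); t) = 0` (here `x₂ = 0`) from the homotopy identity for `da` and `t`,
the differential of that for `a` and `t`, and that for `a` and `dt`. -/
theorem eq_zero_of_homotopy_identities {M : Type*} [AddCommGroup M] [Module k M] {s s' : k}
    {x₁ x₂ x₃ x₄ a a' b b' : M} (hs : s' = -s) (h₁ : x₁ + x₂ + s' • x₃ = a - b)
    (h₂ : 0 + x₁ + s • x₄ = a + s • a' - (b + s • b')) (h₃ : x₄ + x₃ = a' - b') : x₂ = 0 := by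
  have h : x₂ = (x₁ + x₂ + s' • x₃) - (0 + x₁ + s • x₄) + s • (x₄ + x₃) := by
    rw [hs]
    module
  rw [h, h₁, h₂, h₃]
  module

/-- The homotopy only depends on the morphism of `C ⊗̃ D` given by the expression. -/
theorem homotopy_congr {X Y : C.Obj × D.Obj} {n : ℤ} {a b : Term C D X Y n} (hab : Term.Rel a b) :
    ∀ {W : C.Obj × D.Obj} {r m : ℤ} (h : n + r = m + 1) (t : TensorHom C D W X r),
      homotopy a h t = homotopy b h t := by
  induction hab with
  | refl => intros; rfl
  | symm _ ih => intros; exact (ih _ _).symm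
  | trans _ _ ih₁ ih₂ => intros; exact (ih₁ _ _).trans (ih₂ _ _)
  | add_congr _ _ ih₁ ih₂ =>
    intro W r m h t
    rw [(isAdditive_homotopy h t).add, (isAdditive_homotopy h t).add, ih₁, ih₂]
  | smul_congr _ _ ih =>
    intro W r m h t
    rw [(isAdditive_homotopy h t).smul, (isAdditive_homotopy h t).smul, ih]
  | @comp_congr X Y Z p q n hn b b' a a' hb ha ihb iha =>
    intro W r m h t
    rw [homotopy_comp (j := p + r - 1) hn b a h rfl (by omega) (by omega) (by omega),
      homotopy_comp (j := p + r - 1) hn b' a' h rfl (by omega) (by omega) (by omega), ihb, iha,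
      sound hb, Term.eval_eq_of_rel ha]
  | @d_congr X Y n n' hn a a' ha ih =>
    intro W r m h t
    -- the homotopy identity expresses `H(da; t)` by the values of `H` on `a`
    have h₁ := d_homotopy a (m := m - 1) rfl (by omega) hn rfl (by omega) (by omega) (by omega) t
    have h₂ := d_homotopy a' (m := m - 1) rfl (by omega) hn rfl (by omega) (by omega) (by omega) t
    obtain rfl : m = n + r := by omega
    rw [ih, ih, sound ha, Term.eval_eq_of_rel ha, ← h₂] at h₁
    exact add_left_cancel (add_right_cancel h₁)
  | add_assoc => intros; exact _root_.add_assoc _ _ _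
  | add_comm => intros; exact _root_.add_comm _ _
  | add_zero => intros; exact _root_.add_zero _
  | zero_smul a =>
    intro W r m h t
    exact ((isAdditive_homotopy h t).smul 0 a).trans (_root_.zero_smul _ _)
  | one_smul a =>
    intro W r m h t
    exact ((isAdditive_homotopy h t).smul 1 a).trans (_root_.one_smul _ _)
  | mul_smul s s' a =>
    intro W r m h t
    simp only [(isAdditive_homotopy h t).smul, SemigroupAction.mul_smul]
  | smul_add s a b =>
    intro W r m h t
    simp only [(isAdditive_homotopy h t).smul, (isAdditive_homotopy h t).add, _root_.smul_add]
  | add_smul s s' a =>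
    intro W r m h t
    simp only [(isAdditive_homotopy h t).smul, (isAdditive_homotopy h t).add, _root_.add_smul]
  | @id_comp X Y n hn a =>
    intro W r m h t
    rw [homotopy_comp (j := m) hn _ a h rfl (by omega) (by omega) (by omega), sgn_zero,
      _root_.one_smul, id_comp]
    exact _root_.zero_add _
  | @comp_id X Y n hn a =>
    intro W r m h t
    rw [homotopy_comp (i := r) (j := r - 1) hn a _ h (by omega) (by omega) (by omega) (by omega)]
    have ht : tensorComp (zero_add r) (Term.eval (.id X)) t = t :=
      (tensor C D).id_comp (zero_add r) t
    change _ + sgn k n • comp _ (mk a) 0 = _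
    rw [ht, map_zero, _root_.smul_zero, _root_.add_zero]
  | @assoc W' X Y Z p q r' pq qr n h₁ h₂ h₃ h₄ c b a =>
    intro W r m h t
    subst h₁ h₃
    rw [homotopy_comp (j := p + r - 1) h₂ _ a h rfl (by omega) (by omega) (by omega),
      homotopy_comp (j := q + p + r - 1) (i := q + (p + r)) _ c b _ (by omega) (by omega)
        (by omega) (by omega),
      homotopy_comp (j := q + p + r - 1) (i := q + (p + r)) h₄ c _ h (by omega) (by omega)
        (by omega) (by omega),
      homotopy_comp (j := p + r - 1) (i := p + r) rfl b a _ (by omega) (by omega)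
        (by omega) (by omega), mk_comp,
      comp_assoc rfl _ (by omega : q + (p + r - 1) = q + p + r - 1) (by omega)]
    have he : Term.eval (.comp rfl b a) = tensorComp (rfl : q + p = q + p) b.eval a.eval := rfl
    rw [he, tensorComp_assoc rfl _ rfl (by omega), map_add, map_smul, _root_.smul_add, smul_smul,
      sgn_add, _root_.add_assoc]
  | @add_comp X Y Z p q n hn b b' a =>
    intro W r m h t
    rw [(isAdditive_homotopy h t).add,
      homotopy_comp (j := p + r - 1) hn _ a h rfl (by omega) (by omega) (by omega),
      homotopy_comp (j := p + r - 1) hn b a h rfl (by omega) (by omega) (by omega),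
      homotopy_comp (j := p + r - 1) hn b' a h rfl (by omega) (by omega) (by omega),
      (isAdditive_homotopy _ _).add, mk_add, map_add, LinearMap.add_apply]
    module
  | @smul_comp X Y Z p q n hn s b a =>
    intro W r m h t
    rw [(isAdditive_homotopy h t).smul,
      homotopy_comp (j := p + r - 1) hn _ a h rfl (by omega) (by omega) (by omega),
      homotopy_comp (j := p + r - 1) hn b a h rfl (by omega) (by omega) (by omega),
      (isAdditive_homotopy _ _).smul, mk_smul, map_smul, LinearMap.smul_apply]
    module
  | @comp_add X Y Z p q n hn b a a' =>
    intro W r m h t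
    rw [(isAdditive_homotopy h t).add,
      homotopy_comp (j := p + r - 1) hn b _ h rfl (by omega) (by omega) (by omega),
      homotopy_comp (j := p + r - 1) hn b a h rfl (by omega) (by omega) (by omega),
      homotopy_comp (j := p + r - 1) hn b a' h rfl (by omega) (by omega) (by omega),
      (isAdditive_homotopy _ _).add, Term.eval]
    simp only [map_add, LinearMap.add_apply]
    module
  | @comp_smul X Y Z p q n hn s b a =>
    intro W r m h t
    rw [(isAdditive_homotopy h t).smul,
      homotopy_comp (j := p + r - 1) hn b _ h rfl (by omega) (by omega) (by omega),
      homotopy_comp (j := p + r - 1) hn b a h rfl (by omega) (by omega) (by omega),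
      (isAdditive_homotopy _ _).smul, Term.eval]
    simp only [map_smul, LinearMap.smul_apply]
    module
  | @d_d X Y n n' n'' hn hn' a =>
    intro W r m h t
    obtain rfl : m = n' + r := by omega
    have h₁ := d_homotopy (a.d n' hn) (m := n + r) (r' := r + 1) rfl (by omega) hn' rfl (by omega)
      h (by omega) t
    have h₂ := congrArg (TwistedHom.d (n + r) (n' + r) (by omega))
      (d_homotopy a (m := n + r - 1) rfl (by omega) hn rfl (by omega) (by omega) (by omega) t)
    have h₃ := d_homotopy a (m := n + r) (l := n' + r) (r' := r + 1 + 1) (by omega) (by omega) hn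
      rfl (by omega) (by omega) (by omega) (tensorD r (r + 1) rfl t)
    simp only [map_add, map_sub, map_smul, d_d, tensorD_tensorD, map_zero, _root_.smul_zero,
      _root_.add_zero, d_ofTensor] at h₁ h₂ h₃
    rw [d_comp (by omega) _ rfl hn (by omega) (by omega),
      tensorD_comp (by omega) _ rfl hn (by omega) (by omega), map_add, map_smul, d_ofTensor,
      ← Term.eval_d, ← mk_d] at h₂
    exact eq_zero_of_homotopy_identities (by rw [← hn, sgn_add, sgn_one, mul_neg_one]) h₁ h₂ h₃
  | right_add => intros; exact (_root_.add_zero _).symm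
  | right_smul c s g =>
    intro W r m h t
    rw [(isAdditive_homotopy h t).smul, homotopy_right, homotopy_right, _root_.smul_zero]
  | @right_comp c d₀ d₁ d₂ p q n hn g₂ g₁ =>
    intro W r m h t
    rw [homotopy_comp (j := p + r - 1) hn _ _ h rfl (by omega) (by omega) (by omega),
      homotopy_right, homotopy_right, homotopy_right, map_zero, _root_.smul_zero, _root_.add_zero]
  | @eps_add c c' d d' p n f f' x hx =>
    intro W r m h t
    obtain ⟨c₀, d₀⟩ := W
    refine LinearMap.congr_fun (f := homotopy (.eps (f + f') x hx) h)
      (g := homotopy (.eps f x hx) h + homotopy (.eps f' x hx) h) (tensorHom_ext ?_) t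
    intro a b hab φ g
    rw [LinearMap.add_apply, homotopy_eps_tmul (i := m - a) _ _ _ _ _ (by omega),
      homotopy_eps_tmul (i := m - a) _ _ _ _ _ (by omega),
      homotopy_eps_tmul (i := m - a) _ _ _ _ _ (by omega), map_add, map_add,
      LinearMap.add_apply, _root_.smul_add]
  | @eps_smul c c' d d' p n s f x hx =>
    intro W r m h t
    obtain ⟨c₀, d₀⟩ := W
    refine LinearMap.congr_fun (f := homotopy (.eps (s • f) x hx) h)
      (g := s • homotopy (.eps f x hx) h) (tensorHom_ext ?_) t
    intro a b hab φ g
    rw [LinearMap.smul_apply, homotopy_eps_tmul (i := m - a) _ _ _ _ _ (by omega),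
      homotopy_eps_tmul (i := m - a) _ _ _ _ _ (by omega), map_smul, map_smul,
      LinearMap.smul_apply, smul_comm]
  | @eps_chain_add c c' d₀ d₁ d₂ d₃ p q n f y g g' x hx hx₁ hx₂ =>
    intro W r m h t
    obtain ⟨c₀, e⟩ := W
    refine LinearMap.congr_fun (f := homotopy (.eps f (append y (cons (g + g') x)) hx) h)
      (g := homotopy (.eps f _ hx₁) h + homotopy (.eps f _ hx₂) h) (tensorHom_ext ?_) t
    intro a b hab φ g₁
    rw [LinearMap.add_apply, homotopy_eps_tmul (i := m - a) _ _ _ _ _ (by omega),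
      homotopy_eps_tmul (i := m - a) _ _ _ _ _ (by omega),
      homotopy_eps_tmul (i := m - a) _ _ _ _ _ (by omega), snoc_append, snoc_append, snoc_append,
      epsMor_append_cons_add, map_add, LinearMap.add_apply, _root_.smul_add]
  | @eps_chain_smul c c' d₀ d₁ d₂ d₃ p q n f s y g x hx hx₁ =>
    intro W r m h t
    obtain ⟨c₀, e⟩ := W
    refine LinearMap.congr_fun (f := homotopy (.eps f (append y (cons (s • g) x)) hx) h)
      (g := s • homotopy (.eps f _ hx₁) h) (tensorHom_ext ?_) t
    intro a b hab φ g₁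
    rw [LinearMap.smul_apply, homotopy_eps_tmul (i := m - a) _ _ _ _ _ (by omega),
      homotopy_eps_tmul (i := m - a) _ _ _ _ _ (by omega), snoc_append, snoc_append,
      epsMor_append_cons_smul, map_smul, LinearMap.smul_apply, smul_comm]
  | @eps_chain_id c c' d₀ d₁ d₂ p n f y x hx =>
    intro W r m h t
    obtain ⟨c₀, e⟩ := W
    refine LinearMap.congr_fun (f := homotopy (.eps f _ hx) h) (g := 0) (tensorHom_ext ?_) t
    intro a b hab φ g₁
    rw [homotopy_eps_tmul (i := m - a) _ _ _ _ _ (by omega), snoc_append,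
      epsMor_append_cons_id, map_zero, LinearMap.zero_apply, _root_.smul_zero,
      LinearMap.zero_apply]
  | @eps_id c d₀ d₁ d₂ q n g x hx =>
    intro W r m h t
    obtain ⟨c₀, e⟩ := W
    refine LinearMap.congr_fun (f := homotopy (.eps (C.id c) _ hx) h) (g := 0) (tensorHom_ext ?_) t
    intro a b hab φ g₁
    rw [homotopy_eps_tmul (i := m - a) _ _ _ _ _ (by omega), epsMor_id_snoc, map_zero,
      LinearMap.zero_apply, _root_.smul_zero, LinearMap.zero_apply]
  | eps_comp hp f₂ f₁ x hx =>
    intro W r m h t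
    exact homotopy_eps_comp hp f₂ f₁ x hx h t
  | right_id => intros; rfl
  | eps_id_nil c d hx =>
    intro W r m h t
    obtain ⟨c₀, e⟩ := W
    refine LinearMap.congr_fun (f := homotopy (.eps (C.id c) _ hx) h) (g := 0) (tensorHom_ext ?_) t
    intro a b hab φ g₁
    rw [homotopy_eps_tmul (i := m - a) _ _ _ _ _ (by omega), epsMor_id_snoc, map_zero,
      LinearMap.zero_apply, _root_.smul_zero, LinearMap.zero_apply]

/-! ### The projection is a quasi-equivalence -/

theorem d_ofTensor_eq_zero {X Y : C.Obj × D.Obj} {n m : ℤ} (h : n + 1 = m)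
    {t : TensorHom C D X Y n} (ht : tensorD n m h t = 0) : d n m h (ofTensor t) = 0 := by
  rw [d_ofTensor, ht, map_zero]

/-- A cocycle `x` of `C ⊗̃ D` whose projection is a coboundary is a coboundary: it is cohomologous
to the section of its projection by the homotopy identity for `t = id`. -/
theorem exists_d_eq {X Y : C.Obj × D.Obj} {m n l : ℤ} (hm : m + 1 = n) (hn : n + 1 = l)
    {x : TwistedHom C D X Y n} (hx : d n l hn x = 0) {y : TensorHom C D X Y m}
    (hy : tensorD m n hm y = projectionMap x) : ∃ z, d m n hm z = x := by
  induction x using ind with | _ a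
  have hda : Term.Rel (a.d l hn) .zero := Quotient.exact hx
  have h := d_homotopy a (add_zero n) hm hn rfl (by omega) (by omega) (by omega)
    (tmul (add_zero 0) (C.id X.1) (D.id X.2))
  have hid : tensorD 0 (0 + 1) rfl (tmul (add_zero 0) (C.id X.1) (D.id X.2)) = 0 :=
    (tensor C D).d_id X _ rfl
  have hy' : tensorD m n hm y = a.eval := hy
  rw [homotopy_congr hda, (isAdditive_homotopy _ _).zero, hid, map_zero, smul_zero, add_zero,
    add_zero, ofTensor_id, comp_id, tensorComp_id, ← hy', ← d_ofTensor, eq_sub_iff_add_eq,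
    ← map_add] at h
  exact ⟨_, h⟩

end TwistedHom

theorem HomotopyEquivalent.refl (C : DGCat.{w, u, v} k) (X : C.Obj) :
    C.HomotopyEquivalent X X :=
  ⟨C.id X, C.d_id X _ _, C.id X, C.d_id X _ _, by
    rw [C.id_comp, sub_self]
    exact ⟨zero_mem _, zero_mem _⟩⟩

/-- The projection `C ⊗̃ D → C ⊗ D` is a quasi-equivalence, without any assumption on `C` and
`D`. -/
theorem isQuasiEquivalence_projection (C : DGCat.{w, u₁, v₁} k) (D : DGCat.{w, u₂, v₂} k) :
    (projection C D).IsQuasiEquivalence where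
  essSurj Z := ⟨Z, .refl _ Z⟩
  bijective_mapCohomology X Y n := by
    constructor
    · rw [injective_iff_map_eq_zero]
      intro ξ hξ
      obtain ⟨⟨x, hx⟩, rfl⟩ := Submodule.Quotient.mk_surjective _ ξ
      obtain ⟨y, hy⟩ := (Submodule.Quotient.mk_eq_zero _).1 hξ
      exact (Submodule.Quotient.mk_eq_zero _).2
        (TwistedHom.exists_d_eq (X := X) (Y := Y) (sub_add_cancel n 1) rfl hx hy)
    · intro η
      obtain ⟨⟨y, hy⟩, rfl⟩ := Submodule.Quotient.mk_surjective _ η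
      have hs : (twisted C D).d n (n + 1) rfl (TwistedHom.ofTensor (X := X) (Y := Y) y) = 0 :=
        TwistedHom.d_ofTensor_eq_zero (X := X) (Y := Y) rfl hy
      have hp : (projection C D).mapCocycles X Y n ⟨TwistedHom.ofTensor (X := X) (Y := Y) y, hs⟩ =
          ⟨y, hy⟩ := Subtype.ext (TwistedHom.projectionMap_ofTensor (X := X) (Y := Y) y)
      exact ⟨Submodule.Quotient.mk ⟨TwistedHom.ofTensor (X := X) (Y := Y) y, hs⟩,
        congrArg Submodule.Quotient.mk hp⟩

end DGCat
end

theorem theorem3 {k : Type w} [Field k] (C : DGCat.{w, u, v} k) (n : ℕ) :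
    (DGCat.projection (DGCat.interval k n) C).IsQuasiEquivalence :=
  DGCat.isQuasiEquivalence_projection _ _
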